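/- All vector spaces are over $\mathbb{Q}$ and graded over $\mathbb{Z}$. A DGL is a differential graded Lie algebra $L=\bigoplus_{n\in\mathbb{Z}}L_n$ with differential $\partial$ of degree $-1$ (no connectivity or finiteness is assumed); a DGL morphism is a quasi-isomorphism if it induces an isomorphism on $H_*$. Let $k\ge 2$ and $n_1,\dots,n_k\in\mathbb{Z}$, and put $N=n_1+\cdots+n_k$. Let $\mathbb{L}(U)$ be the free graded Lie algebra on generators $u_S$, one for each $S$ with $\emptyset\ne S\subsetneq\{1,\dots,k\}$, of degree $|u_S|=\sum_{i\in S}n_i-1$, with the differential determined by $$\partial u_S=\sum_{S=A\sqcup B,\ \min S\in A,\ B\neq\emptyset}(-1)^{|u_A|}\,\varepsilon(A,B)\,[u_A,u_B],\qquad \varepsilon(A,B)=\prod_{a\in A,\ b\in B,\ b<a}(-1)^{n_an_b}$$ (so each $u_i=u_{\{i\}}$ is a cycle). Let $w\in\mathbb{L}(U)$ be the cycle of degree $N-2$ given by the right-hand side of this formula for $S=\{1,\dots,k\}$. For a DGL $L$ and classes $x_i\in H_{n_i-1}(L)$, $1\le i\le k$, the $k$th order Whitehead bracket set is the (possibly empty)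 set $$[x_1,\dots,x_k]=\bigl\{\overline{\phi(w)}\ \bigm|\ \phi:\mathbb{L}(U)\to L\text{ a DGL morphism such that }\phi(u_i)\text{ represents }x_i\text{ for }1\le i\le k\bigr\}\subseteq H_{N-2}(L).$$ **Proposition.** Let $\varphi:L\to L'$ be a DGL quasi-isomorphism, let $k\ge2$, $n_1,\dots,n_k\in\mathbb{Z}$, and let $x_i\in H_{n_i-1}(L)$ for $1\le i\le k$. Then: 1. $0\in[x_1,\dots,x_k]$ if and only if $0\in[\varphi_*(x_1),\dots,\varphi_*(x_k)]$. 2. The map $\varphi_*:H_{N-2}(L)\to H_{N-2}(L')$ restricts to a bijection from $[x_1,\dots,x_k]$ onto $[\varphi_*(x_1),\dots,\varphi_*(x_k)]$. In particular, $\#[x_1,\dots,x_k]=\#[\varphi_*(x_1),\dots,\varphi_*(x_k)]$. -/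

import Mathlib

universe u v

/-! ## Differential graded Lie algebras over `ℚ` (graded over `ℤ`, differential of degree `-1`) -/

/-- `br` is a graded Lie bracket on `V = ⨁ gr n`. -/
structure IsGradedLie {V : Type*} [AddCommGroup V] [Module ℚ V]
    (gr : ℤ → Submodule ℚ V) (br : V →ₗ[ℚ] V →ₗ[ℚ] V) : Prop where
  internal : DirectSum.IsInternal gr
  br_mem : ∀ {i j : ℤ} {x y : V}, x ∈ gr i → y ∈ gr j → br x y ∈ gr (i + j)
  br_anti : ∀ {i j : ℤ} {x y : V}, x ∈ gr i → y ∈ gr j →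
    br x y = -((-1 : ℚ) ^ (i * j) • br y x)
  jacobi : ∀ {i j l : ℤ} {x y z : V}, x ∈ gr i → y ∈ gr j → z ∈ gr l →
    br x (br y z) = br (br x y) z + (-1 : ℚ) ^ (i * j) • br y (br x z)

/-- `d` is a derivation of degree `-1` of the bracket `br`. -/
structure IsDerivation {V : Type*} [AddCommGroup V] [Module ℚ V]
    (gr : ℤ → Submodule ℚ V) (br : V →ₗ[ℚ] V →ₗ[ℚ] V) (d : V →ₗ[ℚ] V) : Prop where
  d_mem : ∀ {i : ℤ} {x : V}, x ∈ gr i → d x ∈ gr (i - 1)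
  leibniz : ∀ {i : ℤ} {x : V} (y : V), x ∈ gr i →
    d (br x y) = br (d x) y + (-1 : ℚ) ^ i • br x (d y)

/-- A differential graded Lie algebra over `ℚ`, without any connectivity or finiteness assumption. -/
structure DGLie : Type (u + 1) where
  carrier : Type u
  [addCommGroup : AddCommGroup carrier]
  [module : Module ℚ carrier]
  gr : ℤ → Submodule ℚ carrier
  br : carrier →ₗ[ℚ] carrier →ₗ[ℚ] carrier
  d : carrier →ₗ[ℚ] carrier
  isGradedLie : IsGradedLie gr br
  isDerivation : IsDerivation gr br d
  d_d : ∀ x, d (d x) = 0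

attribute [instance] DGLie.addCommGroup DGLie.module

namespace DGLie

/-- The cycles of degree `n`. -/
def cycles (L : DGLie) (n : ℤ) : Submodule ℚ L.carrier := LinearMap.ker L.d ⊓ L.gr n

/-- The boundaries of degree `n`, inside the cycles of degree `n`. -/
def boundaries (L : DGLie) (n : ℤ) : Submodule ℚ (L.cycles n) :=
  (Submodule.map L.d (L.gr (n + 1))).comap (L.cycles n).subtype

/-- The homology `H_n(L)`. -/
abbrev H (L : DGLie) (n : ℤ) : Type _ := L.cycles n ⧸ L.boundaries n

/-- The homology class of a cycle. -/
def cls (L : DGLie) {n : ℤ} (z : L.carrier) (hd : L.d z = 0) (hz : z ∈ L.gr n) : L.H n :=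
  (L.boundaries n).mkQ ⟨z, hd, hz⟩

/-- Morphisms of differential graded Lie algebras. -/
structure Hom (L : DGLie) (L' : DGLie) where
  toFun : L.carrier →ₗ[ℚ] L'.carrier
  map_gr : ∀ {n : ℤ} {x : L.carrier}, x ∈ L.gr n → toFun x ∈ L'.gr n
  map_br : ∀ x y, toFun (L.br x y) = L'.br (toFun x) (toFun y)
  map_d : ∀ x, toFun (L.d x) = L'.d (toFun x)

namespace Hom

variable {L : DGLie.{u}} {L' : DGLie.{v}}

/-- The map induced on cycles. -/
def mapCycles (f : Hom L L') (n : ℤ) : L.cycles n →ₗ[ℚ] L'.cycles n :=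
  f.toFun.restrict fun x hx => by
    refine ⟨?_, f.map_gr hx.2⟩
    have h : L.d x = 0 := hx.1
    change L'.d (f.toFun x) = 0
    rw [← f.map_d, h, map_zero]

/-- The map `f_* : H_n(L) → H_n(L')` induced on homology. -/
def mapH (f : Hom L L') (n : ℤ) : L.H n →ₗ[ℚ] L'.H n :=
  (L.boundaries n).mapQ (L'.boundaries n) (f.mapCycles n) fun x hx => by
    obtain ⟨y, hy, hyx⟩ := hx
    refine ⟨f.toFun y, f.map_gr hy, ?_⟩
    rw [← f.map_d, hyx]
    rfl

/-- A quasi-isomorphism: a morphism inducing isomorphisms in homology in all degrees. -/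
def IsQuasiIso (f : Hom L L') : Prop := ∀ n : ℤ, Function.Bijective (f.mapH n)

end Hom

end DGLie

/-! ## The free graded Lie algebra on a graded set

It is the quotient of the free non-associative algebra `FreeMagma ι →₀ ℚ` by the two-sided ideal
generated by graded antisymmetry and the graded Jacobi identity. -/

namespace FreeGradedLie

variable {ι : Type*}

/-- The degree of a non-associative monomial. -/
def mdeg (deg : ι → ℤ) : FreeMagma ι → ℤ
  | .of i => deg i
  | .mul a b => mdeg deg a + mdeg deg b

/-- A monomial, as an element of the free non-associative algebra. -/
noncomputable def mon (a : FreeMagma ι) : FreeMagma ι →₀ ℚ := Finsupp.single a 1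

/-- The multiplication of the free non-associative algebra. -/
noncomputable def mulNA :
    (FreeMagma ι →₀ ℚ) →ₗ[ℚ] (FreeMagma ι →₀ ℚ) →ₗ[ℚ] (FreeMagma ι →₀ ℚ) :=
  Finsupp.linearCombination ℚ fun a => Finsupp.linearCombination ℚ fun b => mon (a.mul b)

/-- The elements of degree `n` of the free non-associative algebra. -/
noncomputable def grNA (deg : ι → ℤ) (n : ℤ) : Submodule ℚ (FreeMagma ι →₀ ℚ) :=
  Submodule.span ℚ (mon '' {a | mdeg deg a = n})

/-- The multiples by monomials of the relators of a graded Lie algebra. -/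
inductive Rel (deg : ι → ℤ) : (FreeMagma ι →₀ ℚ) → Prop
  | anti (a b : FreeMagma ι) : Rel deg
      (mulNA (mon a) (mon b) + (-1 : ℚ) ^ (mdeg deg a * mdeg deg b) • mulNA (mon b) (mon a))
  | jacobi (a b c : FreeMagma ι) : Rel deg
      (mulNA (mon a) (mulNA (mon b) (mon c)) - mulNA (mulNA (mon a) (mon b)) (mon c)
        - (-1 : ℚ) ^ (mdeg deg a * mdeg deg b) • mulNA (mon b) (mulNA (mon a) (mon c)))
  | mul_left (a : FreeMagma ι) {r : FreeMagma ι →₀ ℚ} : Rel deg r → Rel deg (mulNA (mon a) r)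
  | mul_right (a : FreeMagma ι) {r : FreeMagma ι →₀ ℚ} : Rel deg r → Rel deg (mulNA r (mon a))

/-- The two-sided ideal generated by the relators. -/
noncomputable def relIdeal (deg : ι → ℤ) : Submodule ℚ (FreeMagma ι →₀ ℚ) :=
  Submodule.span ℚ {r | Rel deg r}

/-- The free graded Lie algebra on generators `i : ι` of degree `deg i`. -/
abbrev Carrier (deg : ι → ℤ) : Type _ := (FreeMagma ι →₀ ℚ) ⧸ relIdeal deg

/-- The elements of degree `n` of the free graded Lie algebra. -/
noncomputable def gr (deg : ι → ℤ) (n : ℤ) : Submodule ℚ (Carrier deg) :=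
  (grNA deg n).map (relIdeal deg).mkQ

lemma mulNA_mon (a b : FreeMagma ι) : mulNA (mon a) (mon b) = mon (a.mul b) := by
  simp [mulNA, mon]

lemma mon_mem (deg : ι → ℤ) (a : FreeMagma ι) : mon a ∈ grNA deg (mdeg deg a) :=
  Submodule.subset_span ⟨a, rfl, rfl⟩

lemma lin_ext {S : Submodule ℚ (FreeMagma ι →₀ ℚ)} (h : ∀ a, mon a ∈ S)
    (x : FreeMagma ι →₀ ℚ) : x ∈ S := by
  induction x using Finsupp.induction_linear with
  | zero => exact S.zero_mem
  | add f g hf hg => exact S.add_mem hf hg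
  | single a c =>
    have : Finsupp.single a c = c • mon a := by simp [mon]
    rw [this]
    exact S.smul_mem _ (h a)

lemma grNA_le {deg : ι → ℤ} {n : ℤ} {S : Submodule ℚ (FreeMagma ι →₀ ℚ)}
    (h : ∀ a, mdeg deg a = n → mon a ∈ S) : grNA deg n ≤ S := by
  refine Submodule.span_le.2 ?_
  rintro _ ⟨a, ha, rfl⟩
  exact h a ha

lemma mulNA_mem_grNA {deg : ι → ℤ} {i j : ℤ} {x y : FreeMagma ι →₀ ℚ} (hx : x ∈ grNA deg i)
    (hy : y ∈ grNA deg j) : mulNA x y ∈ grNA deg (i + j) := by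
  have h1 : ∀ a, mdeg deg a = i → grNA deg j ≤ (grNA deg (i + j)).comap (mulNA (mon a)) := by
    intro a ha
    refine grNA_le fun b hb => ?_
    rw [Submodule.mem_comap, mulNA_mon, ← ha, ← hb]
    exact mon_mem deg (a.mul b)
  have h2 : grNA deg i ≤ (grNA deg (i + j)).comap (mulNA.flip y) :=
    grNA_le fun a ha => h1 a ha hy
  exact h2 hx

lemma mulNA_mem_right {deg : ι → ℤ} (x : FreeMagma ι →₀ ℚ) {r : FreeMagma ι →₀ ℚ}
    (hr : r ∈ relIdeal deg) : mulNA x r ∈ relIdeal deg := by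
  have h1 : ∀ a, relIdeal deg ≤ (relIdeal deg).comap (mulNA (mon a)) := fun a =>
    Submodule.span_le.2 fun r hr => Submodule.subset_span (Rel.mul_left a hr)
  exact lin_ext (S := (relIdeal deg).comap (mulNA.flip r)) (fun a => h1 a hr) x

lemma mulNA_mem_left {deg : ι → ℤ} (x : FreeMagma ι →₀ ℚ) {r : FreeMagma ι →₀ ℚ}
    (hr : r ∈ relIdeal deg) : mulNA r x ∈ relIdeal deg := by
  have h1 : ∀ a, relIdeal deg ≤ (relIdeal deg).comap (mulNA.flip (mon a)) := fun a =>
    Submodule.span_le.2 fun r hr => Submodule.subset_span (Rel.mul_right a hr)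
  exact lin_ext (S := (relIdeal deg).comap (mulNA r)) (fun a => h1 a hr) x

/-- The bracket of the free graded Lie algebra. -/
noncomputable def br (deg : ι → ℤ) : Carrier deg →ₗ[ℚ] Carrier deg →ₗ[ℚ] Carrier deg :=
  (relIdeal deg).liftQ
    { toFun := fun x => (relIdeal deg).mapQ (relIdeal deg) (mulNA x)
        fun _ hr => mulNA_mem_right x hr
      map_add' := fun x y => by ext; simp
      map_smul' := fun c x => by ext; simp }
    fun r hr => by
      refine LinearMap.ext fun q => ?_
      obtain ⟨x, rfl⟩ := (relIdeal deg).mkQ_surjective q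
      exact (Submodule.Quotient.mk_eq_zero _).2 (mulNA_mem_left x hr)

lemma br_mk (deg : ι → ℤ) (x y : FreeMagma ι →₀ ℚ) :
    br deg ((relIdeal deg).mkQ x) ((relIdeal deg).mkQ y) = (relIdeal deg).mkQ (mulNA x y) := rfl

lemma anti_mem {deg : ι → ℤ} {i j : ℤ} {x y : FreeMagma ι →₀ ℚ} (hx : x ∈ grNA deg i)
    (hy : y ∈ grNA deg j) : mulNA x y + (-1 : ℚ) ^ (i * j) • mulNA y x ∈ relIdeal deg := by
  have h1 : ∀ a, mdeg deg a = i → grNA deg j ≤ (relIdeal deg).comap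
      (mulNA (mon a) + (-1 : ℚ) ^ (i * j) • mulNA.flip (mon a)) := by
    intro a ha
    refine grNA_le fun b hb => ?_
    subst ha hb
    exact Submodule.subset_span (Rel.anti a b)
  have h2 : grNA deg i ≤ (relIdeal deg).comap
      (mulNA.flip y + (-1 : ℚ) ^ (i * j) • mulNA y) :=
    grNA_le fun a ha => h1 a ha hy
  exact h2 hx

lemma jacobi_mem {deg : ι → ℤ} {i j l : ℤ} {x y z : FreeMagma ι →₀ ℚ} (hx : x ∈ grNA deg i)
    (hy : y ∈ grNA deg j) (hz : z ∈ grNA deg l) :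
    mulNA x (mulNA y z) - mulNA (mulNA x y) z - (-1 : ℚ) ^ (i * j) • mulNA y (mulNA x z)
      ∈ relIdeal deg := by
  have h1 : ∀ a b, mdeg deg a = i → mdeg deg b = j → grNA deg l ≤ (relIdeal deg).comap
      (mulNA (mon a) ∘ₗ mulNA (mon b) - mulNA (mulNA (mon a) (mon b))
        - (-1 : ℚ) ^ (i * j) • mulNA (mon b) ∘ₗ mulNA (mon a)) := by
    intro a b ha hb
    refine grNA_le fun c hc => ?_
    subst ha hb hc
    exact Submodule.subset_span (Rel.jacobi a b c)
  have h2 : ∀ a, mdeg deg a = i → grNA deg j ≤ (relIdeal deg).comap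
      (mulNA (mon a) ∘ₗ mulNA.flip z - mulNA.flip z ∘ₗ mulNA (mon a)
        - (-1 : ℚ) ^ (i * j) • mulNA.flip (mulNA (mon a) z)) :=
    fun a ha => grNA_le fun b hb => h1 a b ha hb hz
  have h3 : grNA deg i ≤ (relIdeal deg).comap
      (mulNA.flip (mulNA y z) - mulNA.flip z ∘ₗ mulNA.flip y
        - (-1 : ℚ) ^ (i * j) • mulNA y ∘ₗ mulNA.flip z) :=
    grNA_le fun a ha => h2 a ha hy
  exact h3 hx

/-- The projection onto the elements of degree `n`. -/
noncomputable def projNA (deg : ι → ℤ) (n : ℤ) : (FreeMagma ι →₀ ℚ) →ₗ[ℚ] (FreeMagma ι →₀ ℚ) :=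
  Finsupp.linearCombination ℚ fun a => if mdeg deg a = n then mon a else 0

lemma projNA_of_mem {deg : ι → ℤ} {n m : ℤ} {x : FreeMagma ι →₀ ℚ} (hx : x ∈ grNA deg m) :
    projNA deg n x = if m = n then x else 0 := by
  have h : grNA deg m ≤ LinearMap.ker (projNA deg n -
      (if m = n then LinearMap.id else 0 : (FreeMagma ι →₀ ℚ) →ₗ[ℚ] _)) := by
    refine grNA_le fun a ha => ?_
    subst ha
    rw [LinearMap.mem_ker]
    by_cases h : mdeg deg a = n <;> simp [projNA, h, mon]
  have h2 := h hx
  rw [LinearMap.mem_ker, LinearMap.sub_apply, sub_eq_zero] at h2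
  rw [h2]
  split_ifs <;> rfl

lemma rel_homogeneous {deg : ι → ℤ} {r : FreeMagma ι →₀ ℚ} (h : Rel deg r) :
    ∃ m, r ∈ grNA deg m := by
  induction h with
  | anti a b =>
    refine ⟨mdeg deg a + mdeg deg b, Submodule.add_mem _ ?_ (Submodule.smul_mem _ _ ?_)⟩
    · exact mulNA_mem_grNA (mon_mem deg a) (mon_mem deg b)
    · rw [add_comm]
      exact mulNA_mem_grNA (mon_mem deg b) (mon_mem deg a)
  | jacobi a b c =>
    have ha := mon_mem deg a
    have hb := mon_mem deg b
    have hc := mon_mem deg c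
    refine ⟨mdeg deg a + (mdeg deg b + mdeg deg c), Submodule.sub_mem _ (Submodule.sub_mem _ ?_ ?_)
      (Submodule.smul_mem _ _ ?_)⟩
    · exact mulNA_mem_grNA ha (mulNA_mem_grNA hb hc)
    · rw [← add_assoc]
      exact mulNA_mem_grNA (mulNA_mem_grNA ha hb) hc
    · rw [add_left_comm]
      exact mulNA_mem_grNA hb (mulNA_mem_grNA ha hc)
  | mul_left a _ ih => exact ih.imp' _ fun m hm => mulNA_mem_grNA (mon_mem deg a) hm
  | mul_right a _ ih => exact ih.imp' _ fun m hm => mulNA_mem_grNA hm (mon_mem deg a)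

/-- The projection onto the elements of degree `n`. -/
noncomputable def proj (deg : ι → ℤ) (n : ℤ) : Carrier deg →ₗ[ℚ] Carrier deg :=
  (relIdeal deg).mapQ (relIdeal deg) (projNA deg n) <| by
    refine Submodule.span_le.2 fun r hr => ?_
    obtain ⟨m, hm⟩ := rel_homogeneous hr
    change projNA deg n r ∈ relIdeal deg
    rw [projNA_of_mem hm]
    split_ifs
    · exact Submodule.subset_span hr
    · exact Submodule.zero_mem _

lemma proj_of_mem {deg : ι → ℤ} {n m : ℤ} {x : Carrier deg} (hx : x ∈ gr deg m) :
    proj deg n x = if m = n then x else 0 := by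
  obtain ⟨y, hy, rfl⟩ := hx
  change (relIdeal deg).mkQ (projNA deg n y) = _
  rw [projNA_of_mem hy]
  split_ifs <;> simp

lemma gr_internal (deg : ι → ℤ) : DirectSum.IsInternal (gr deg) := by
  rw [DirectSum.isInternal_submodule_iff_iSupIndep_and_iSup_eq_top]
  constructor
  · intro n
    rw [Submodule.disjoint_def]
    intro x hx hx'
    have h : (⨆ (j : ℤ) (_ : j ≠ n), gr deg j) ≤ LinearMap.ker (proj deg n) :=
      iSup₂_le fun j hj y hy => by
        rw [LinearMap.mem_ker, proj_of_mem hy, if_neg hj]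
    have h2 : proj deg n x = 0 := h hx'
    rwa [proj_of_mem hx, if_pos rfl] at h2
  · rw [eq_top_iff]
    rintro q -
    obtain ⟨x, rfl⟩ := (relIdeal deg).mkQ_surjective q
    exact lin_ext (S := (⨆ n, gr deg n).comap (relIdeal deg).mkQ)
      (fun a => Submodule.mem_iSup_of_mem (mdeg deg a) ⟨_, mon_mem deg a, rfl⟩) x

lemma isGradedLie (deg : ι → ℤ) : IsGradedLie (gr deg) (br deg) where
  internal := gr_internal deg
  br_mem := by
    rintro i j _ _ ⟨x, hx, rfl⟩ ⟨y, hy, rfl⟩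
    exact ⟨_, mulNA_mem_grNA hx hy, rfl⟩
  br_anti := by
    rintro i j _ _ ⟨x, hx, rfl⟩ ⟨y, hy, rfl⟩
    rw [eq_neg_iff_add_eq_zero]
    exact (Submodule.Quotient.mk_eq_zero _).2 (anti_mem hx hy)
  jacobi := by
    rintro i j l _ _ _ ⟨x, hx, rfl⟩ ⟨y, hy, rfl⟩ ⟨z, hz, rfl⟩
    rw [← sub_eq_zero, ← sub_sub]
    exact (Submodule.Quotient.mk_eq_zero _).2 (jacobi_mem hx hy hz)

/-- The derivation of the free non-associative algebra with prescribed values on generators,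
on monomials. -/
noncomputable def derMon (deg : ι → ℤ) (δ : ι → FreeMagma ι →₀ ℚ) :
    FreeMagma ι → FreeMagma ι →₀ ℚ
  | .of i => δ i
  | .mul a b => mulNA (derMon deg δ a) (mon b) + (-1 : ℚ) ^ mdeg deg a • mulNA (mon a) (derMon deg δ b)

/-- The derivation of the free non-associative algebra with prescribed values on generators. -/
noncomputable def derNA (deg : ι → ℤ) (δ : ι → FreeMagma ι →₀ ℚ) :
    (FreeMagma ι →₀ ℚ) →ₗ[ℚ] (FreeMagma ι →₀ ℚ) :=
  Finsupp.linearCombination ℚ (derMon deg δ)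

lemma derNA_mon (deg : ι → ℤ) (δ : ι → FreeMagma ι →₀ ℚ) (a : FreeMagma ι) :
    derNA deg δ (mon a) = derMon deg δ a := by
  simp [derNA, mon]

lemma derNA_mem {deg : ι → ℤ} {δ : ι → FreeMagma ι →₀ ℚ} (hδ : ∀ i, δ i ∈ grNA deg (deg i - 1))
    {n : ℤ} {x : FreeMagma ι →₀ ℚ} (hx : x ∈ grNA deg n) :
    derNA deg δ x ∈ grNA deg (n - 1) := by
  have h : ∀ a, derMon deg δ a ∈ grNA deg (mdeg deg a - 1) := by
    intro a
    induction a with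
    | ih1 i => exact hδ i
    | ih2 a b iha ihb =>
      refine Submodule.add_mem _ ?_ (Submodule.smul_mem _ _ ?_)
      · have := mulNA_mem_grNA iha (mon_mem deg b)
        rwa [sub_add_eq_add_sub] at this
      · have := mulNA_mem_grNA (mon_mem deg a) ihb
        rwa [← add_sub_assoc] at this
  have h2 : grNA deg n ≤ (grNA deg (n - 1)).comap (derNA deg δ) := by
    refine grNA_le fun a ha => ?_
    subst ha
    rw [Submodule.mem_comap, derNA_mon]
    exact h a
  exact h2 hx

lemma derNA_mul {deg : ι → ℤ} {δ : ι → FreeMagma ι →₀ ℚ} {n : ℤ} {x : FreeMagma ι →₀ ℚ}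
    (hx : x ∈ grNA deg n) (y : FreeMagma ι →₀ ℚ) :
    derNA deg δ (mulNA x y) =
      mulNA (derNA deg δ x) y + (-1 : ℚ) ^ n • mulNA x (derNA deg δ y) := by
  have h1 : ∀ a b, derNA deg δ (mulNA (mon a) (mon b)) = mulNA (derNA deg δ (mon a)) (mon b)
      + (-1 : ℚ) ^ mdeg deg a • mulNA (mon a) (derNA deg δ (mon b)) := by
    intro a b
    rw [mulNA_mon, derNA_mon, derNA_mon, derNA_mon, derMon]
  have h2 : ∀ a, mdeg deg a = n → derNA deg δ ∘ₗ mulNA (mon a) =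
      mulNA (derNA deg δ (mon a)) + (-1 : ℚ) ^ n • mulNA (mon a) ∘ₗ derNA deg δ := by
    intro a ha
    subst ha
    refine LinearMap.ext fun y => sub_eq_zero.1 ?_
    exact lin_ext (S := LinearMap.ker (derNA deg δ ∘ₗ mulNA (mon a) -
      (mulNA (derNA deg δ (mon a)) + (-1 : ℚ) ^ mdeg deg a • mulNA (mon a) ∘ₗ derNA deg δ)))
      (fun b => sub_eq_zero.2 (h1 a b)) y
  have h3 : grNA deg n ≤ LinearMap.ker (derNA deg δ ∘ₗ mulNA.flip y -
      (mulNA.flip y ∘ₗ derNA deg δ + (-1 : ℚ) ^ n • mulNA.flip (derNA deg δ y))) :=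
    grNA_le fun a ha => sub_eq_zero.2 (LinearMap.congr_fun (h2 a ha) y)
  exact sub_eq_zero.1 (h3 hx)

lemma sign_pm (p : ℤ) : (-1 : ℚ) ^ p = 1 ∨ (-1 : ℚ) ^ p = -1 := by
  rcases Int.even_or_odd p with h | h
  · exact Or.inl h.neg_one_zpow
  · exact Or.inr h.neg_one_zpow

lemma sign_mul_left (p q : ℤ) : (-1 : ℚ) ^ (p * q) = ((-1 : ℚ) ^ p) ^ q := zpow_mul _ _ _

lemma sign_sub_one (p : ℤ) : (-1 : ℚ) ^ (p - 1) = -(-1 : ℚ) ^ p := by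
  rw [zpow_sub_one₀ (by norm_num)]; norm_num

lemma sign_add (p q : ℤ) : (-1 : ℚ) ^ (p + q) = (-1 : ℚ) ^ p * (-1 : ℚ) ^ q :=
  zpow_add₀ (by norm_num) p q

lemma derNA_relIdeal {deg : ι → ℤ} {δ : ι → FreeMagma ι →₀ ℚ}
    (hδ : ∀ i, δ i ∈ grNA deg (deg i - 1)) :
    relIdeal deg ≤ (relIdeal deg).comap (derNA deg δ) := by
  refine Submodule.span_le.2 fun r hr => ?_
  change derNA deg δ r ∈ relIdeal deg
  induction hr with
  | anti a b =>
    have ha := mon_mem deg a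
    have hb := mon_mem deg b
    have h1 := anti_mem (derNA_mem hδ ha) hb
    have h2 := Submodule.smul_mem _ ((-1 : ℚ) ^ mdeg deg a) (anti_mem ha (derNA_mem hδ hb))
    have h := Submodule.add_mem _ h1 h2
    convert h using 1
    rw [map_add, map_smul, derNA_mul ha, derNA_mul hb]
    generalize mdeg deg a = p
    generalize mdeg deg b = q
    simp only [mul_sub, sub_mul, one_mul, mul_one, zpow_sub₀ (show (-1 : ℚ) ≠ 0 by norm_num), sign_mul_left]
    rcases sign_pm p with hp | hp <;> rcases sign_pm q with hq | hq <;> simp [hp, hq] <;> module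
  | jacobi a b c =>
    have ha := mon_mem deg a
    have hb := mon_mem deg b
    have hc := mon_mem deg c
    have h1 := jacobi_mem (derNA_mem hδ ha) hb hc
    have h2 := Submodule.smul_mem _ ((-1 : ℚ) ^ mdeg deg a) (jacobi_mem ha (derNA_mem hδ hb) hc)
    have h3 := Submodule.smul_mem _ ((-1 : ℚ) ^ (mdeg deg a + mdeg deg b))
      (jacobi_mem ha hb (derNA_mem hδ hc))
    have h := Submodule.add_mem _ (Submodule.add_mem _ h1 h2) h3
    convert h using 1
    rw [map_sub, map_sub, map_smul, derNA_mul ha, derNA_mul hb, derNA_mul hb, derNA_mul ha,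
      derNA_mul (mulNA_mem_grNA ha hb), derNA_mul ha]
    generalize mdeg deg a = p
    generalize mdeg deg b = q
    simp only [mul_sub, sub_mul, one_mul, mul_one, zpow_sub₀ (show (-1 : ℚ) ≠ 0 by norm_num),
      sign_mul_left, sign_add, map_add, map_smul, LinearMap.add_apply, LinearMap.smul_apply]
    rcases sign_pm p with hp | hp <;> rcases sign_pm q with hq | hq <;> simp [hp, hq] <;> module
  | @mul_left a r hr ih =>
    rw [derNA_mul (mon_mem deg a)]
    exact Submodule.add_mem _ (mulNA_mem_right _ (Submodule.subset_span hr))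
      (Submodule.smul_mem _ _ (mulNA_mem_right _ ih))
  | @mul_right a r hr ih =>
    obtain ⟨m, hm⟩ := rel_homogeneous hr
    rw [derNA_mul hm]
    exact Submodule.add_mem _ (mulNA_mem_left _ ih)
      (Submodule.smul_mem _ _ (mulNA_mem_left _ (Submodule.subset_span hr)))

/-- The derivation of degree `-1` of the free graded Lie algebra whose value on the generator `i`
is the class of `δ i`. -/
noncomputable def der (deg : ι → ℤ) (δ : ι → FreeMagma ι →₀ ℚ)
    (hδ : ∀ i, δ i ∈ grNA deg (deg i - 1)) : Carrier deg →ₗ[ℚ] Carrier deg :=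
  (relIdeal deg).mapQ (relIdeal deg) (derNA deg δ) (derNA_relIdeal hδ)

lemma isDerivation (deg : ι → ℤ) (δ : ι → FreeMagma ι →₀ ℚ)
    (hδ : ∀ i, δ i ∈ grNA deg (deg i - 1)) :
    IsDerivation (gr deg) (br deg) (der deg δ hδ) where
  d_mem := by
    rintro i _ ⟨x, hx, rfl⟩
    exact ⟨_, derNA_mem hδ hx, rfl⟩
  leibniz := by
    rintro i _ y ⟨x, hx, rfl⟩
    obtain ⟨y, rfl⟩ := (relIdeal deg).mkQ_surjective y
    exact congrArg (relIdeal deg).mkQ (derNA_mul hx y)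

/-- The generator `i` of the free graded Lie algebra. -/
noncomputable def gen (deg : ι → ℤ) (i : ι) : Carrier deg := (relIdeal deg).mkQ (mon (.of i))

lemma gen_mem (deg : ι → ℤ) (i : ι) : gen deg i ∈ gr deg (deg i) :=
  ⟨_, mon_mem deg (.of i), rfl⟩

lemma der_gen (deg : ι → ℤ) (δ : ι → FreeMagma ι →₀ ℚ)
    (hδ : ∀ i, δ i ∈ grNA deg (deg i - 1)) (i : ι) :
    der deg δ hδ (gen deg i) = (relIdeal deg).mkQ (δ i) := by
  refine (congrArg (relIdeal deg).mkQ (derNA_mon deg δ (.of i))).trans ?_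
  rw [derMon]

lemma der_der (deg : ι → ℤ) (δ : ι → FreeMagma ι →₀ ℚ)
    (hδ : ∀ i, δ i ∈ grNA deg (deg i - 1))
    (h0 : ∀ i, der deg δ hδ (der deg δ hδ (gen deg i)) = 0) (x : Carrier deg) :
    der deg δ hδ (der deg δ hδ x) = 0 := by
  obtain ⟨x, rfl⟩ := (relIdeal deg).mkQ_surjective x
  refine lin_ext
    (S := LinearMap.ker (der deg δ hδ ∘ₗ der deg δ hδ ∘ₗ (relIdeal deg).mkQ)) (fun a => ?_) x
  change der deg δ hδ (der deg δ hδ ((relIdeal deg).mkQ (mon a))) = 0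
  induction a with
  | ih1 i => exact h0 i
  | ih2 a b iha ihb =>
    have hD := isDerivation deg δ hδ
    have ha : (relIdeal deg).mkQ (mon a) ∈ gr deg (mdeg deg a) := ⟨_, mon_mem deg a, rfl⟩
    have e : (relIdeal deg).mkQ (mon (a * b)) =
        br deg ((relIdeal deg).mkQ (mon a)) ((relIdeal deg).mkQ (mon b)) := by
      rw [br_mk, mulNA_mon]; rfl
    rw [e, hD.leibniz _ ha, map_add, map_smul, hD.leibniz _ (hD.d_mem ha), hD.leibniz _ ha, iha,
      ihb, sign_sub_one]
    simp

end FreeGradedLie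

/-- The free graded Lie algebra on generators `i : ι` of degree `deg i`, with the differential
whose value on the generator `i` is the class of `δ i`. -/
noncomputable def freeDGLie {ι : Type*} (deg : ι → ℤ) (δ : ι → FreeMagma ι →₀ ℚ)
    (hδ : ∀ i, δ i ∈ FreeGradedLie.grNA deg (deg i - 1))
    (h0 : ∀ i, FreeGradedLie.der deg δ hδ (FreeGradedLie.der deg δ hδ (FreeGradedLie.gen deg i)) = 0) :
    DGLie where
  carrier := FreeGradedLie.Carrier deg
  gr := FreeGradedLie.gr deg
  br := FreeGradedLie.br deg
  d := FreeGradedLie.der deg δ hδ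
  isGradedLie := FreeGradedLie.isGradedLie deg
  isDerivation := FreeGradedLie.isDerivation deg δ hδ
  d_d := FreeGradedLie.der_der deg δ hδ h0

/-! ## The differential graded Lie algebra `Lie(U)`

The generators `u_{i_1 … i_s}`, `1 ≤ i_1 < ⋯ < i_s ≤ k`, `1 ≤ s < k`, are indexed by the nonempty
proper subsets `{i_1, …, i_s}` of `Fin k`. -/

namespace FatWedge

variable {k : ℕ}

/-- The degree `n_{i_1} + ⋯ + n_{i_s} - 1` of `u_{i_1 … i_s}`. -/
def udeg (n : Fin k → ℤ) (S : Finset (Fin k)) : ℤ := ∑ i ∈ S, n i - 1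

/-- For `S = A ⊔ B`, the Koszul sign of the shuffle of `S` which lists first the elements of `A` and
then those of `B`, the index `i` having degree `n i`: each inversion, i.e. each pair `a ∈ A`,
`b ∈ B` with `b < a`, contributes `(-1) ^ (n a * n b)`. -/
def koszul (n : Fin k → ℤ) (A B : Finset (Fin k)) : ℚ :=
  ∏ a ∈ A, ∏ b ∈ B, if b < a then (-1 : ℚ) ^ (n a * n b) else 1

/-- The sum `∑ (-1)^{|u_A|} ε(A, B) [u_A, u_B]` over all the decompositions `S = A ⊔ B` with `A` and
`B` nonempty and `A` containing the least element of `S`; these correspond to the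
shuffles of `S` which fix its first element. -/
def shuffleSum {V : Type*} [AddCommGroup V] [Module ℚ V] (n : Fin k → ℤ)
    (br : V →ₗ[ℚ] V →ₗ[ℚ] V) (u : Finset (Fin k) → V) (S : Finset (Fin k)) : V :=
  ∑ A ∈ S.ssubsets with ∃ m ∈ A, ∀ i ∈ S, m ≤ i,
    ((-1 : ℚ) ^ udeg n A * koszul n A (S \ A)) • br (u A) (u (S \ A))

/-- The nonempty proper subsets of `Fin k`. -/
abbrev Index (k : ℕ) : Type := {S : Finset (Fin k) // S.Nonempty ∧ S ≠ Finset.univ}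

/-- The degrees of the generators. -/
def deg (n : Fin k → ℤ) (S : Index k) : ℤ := udeg n S.1

open Classical in
/-- The generator `u_S` in the free non-associative algebra, for `S` nonempty and proper
(and the unused value `0` for other `S`). -/
noncomputable def genNA (S : Finset (Fin k)) : FreeMagma (Index k) →₀ ℚ :=
  if h : S.Nonempty ∧ S ≠ Finset.univ then FreeGradedLie.mon (.of ⟨S, h⟩) else 0

/-- The differential on generators: `∂ u_S = ∑ (-1)^{|u_A|} ε(A, B) [u_A, u_B]`, which is `0` if `S`
is a singleton. -/
noncomputable def δ (n : Fin k → ℤ) (S : Index k) : FreeMagma (Index k) →₀ ℚ :=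
  shuffleSum n FreeGradedLie.mulNA genNA S.1

section signs

open FreeGradedLie

lemma sum_disj (n : Fin k → ℤ) {A B : Finset (Fin k)} (h : Disjoint A B) :
    udeg n (A ∪ B) = udeg n A + udeg n B + 1 := by
  rw [udeg, udeg, udeg, Finset.sum_union h]; ring

lemma koszul_union_right (n : Fin k → ℤ) {A B C : Finset (Fin k)} (h : Disjoint B C) :
    koszul n A (B ∪ C) = koszul n A B * koszul n A C := by
  rw [koszul, koszul, koszul, ← Finset.prod_mul_distrib]
  exact Finset.prod_congr rfl fun a _ => Finset.prod_union h

lemma koszul_union_left (n : Fin k → ℤ) {A B C : Finset (Fin k)} (h : Disjoint A B) :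
    koszul n (A ∪ B) C = koszul n A C * koszul n B C := Finset.prod_union h

lemma sign_sum (s : Finset (Fin k)) (f : Fin k → ℤ) :
    ∏ a ∈ s, (-1 : ℚ) ^ f a = (-1 : ℚ) ^ (∑ a ∈ s, f a) := by
  classical
  induction s using Finset.induction_on with
  | empty => simp
  | insert a s ha ih => rw [Finset.prod_insert ha, Finset.sum_insert ha, ih, sign_add]

lemma koszul_sq (n : Fin k → ℤ) (A B : Finset (Fin k)) : koszul n A B * koszul n A B = 1 := by
  rw [koszul, ← Finset.prod_mul_distrib]
  refine Finset.prod_eq_one fun a _ => ?_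
  rw [← Finset.prod_mul_distrib]
  refine Finset.prod_eq_one fun b _ => ?_
  split_ifs
  · rcases sign_pm (n a * n b) with h | h <;> simp [h]
  · simp

lemma koszul_mul_swap (n : Fin k → ℤ) {A B : Finset (Fin k)} (h : Disjoint A B) :
    koszul n A B * koszul n B A = (-1 : ℚ) ^ ((udeg n A + 1) * (udeg n B + 1)) := by
  have e : koszul n B A = ∏ a ∈ A, ∏ b ∈ B, if a < b then (-1 : ℚ) ^ (n b * n a) else 1 :=
    Finset.prod_comm
  rw [e, koszul, ← Finset.prod_mul_distrib]
  have e2 : ∀ a ∈ A, (∏ b ∈ B, if b < a then (-1 : ℚ) ^ (n a * n b) else 1) *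
      (∏ b ∈ B, if a < b then (-1 : ℚ) ^ (n b * n a) else 1) =
      (-1 : ℚ) ^ (n a * ∑ b ∈ B, n b) := by
    intro a ha
    rw [← Finset.prod_mul_distrib, Finset.mul_sum, ← sign_sum]
    refine Finset.prod_congr rfl fun b hb => ?_
    have hne : a ≠ b := fun hab => Finset.disjoint_left.1 h ha (hab ▸ hb)
    rcases lt_or_gt_of_ne hne with hl | hl
    · rw [if_neg hl.not_gt, if_pos hl, one_mul, mul_comm]
    · rw [if_pos hl, if_neg hl.not_gt, mul_one]
  rw [Finset.prod_congr rfl e2, sign_sum, ← Finset.sum_mul]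
  simp [udeg]

lemma koszul_swap (n : Fin k → ℤ) {A B : Finset (Fin k)} (h : Disjoint A B) :
    koszul n B A = (-1 : ℚ) ^ ((udeg n A + 1) * (udeg n B + 1)) * koszul n A B := by
  rw [← koszul_mul_swap n h, mul_right_comm, koszul_sq, one_mul]

end signs

section identity

open FreeGradedLie

variable {V : Type*} [AddCommGroup V] [Module ℚ V] {gr : ℤ → Submodule ℚ V}
  {br : V →ₗ[ℚ] V →ₗ[ℚ] V} {n : Fin k → ℤ} {u : Finset (Fin k) → V}

lemma shuffleSum_mem {S : Finset (Fin k)}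
    (hbr : ∀ {i j : ℤ} {x y : V}, x ∈ gr i → y ∈ gr j → br x y ∈ gr (i + j))
    (hu : ∀ A, u A ∈ gr (udeg n A)) : shuffleSum n br u S ∈ gr (udeg n S - 1) := by
  refine Submodule.sum_mem _ fun A hA => Submodule.smul_mem _ _ ?_
  have hAS : A ⊆ S := (Finset.mem_ssubsets.1 (Finset.mem_filter.1 hA).1).1
  have h := sum_disj n (A := A) (B := S \ A) Finset.disjoint_sdiff
  rw [Finset.union_sdiff_of_subset hAS] at h
  rw [h, add_sub_cancel_right]
  exact hbr (hu A) (hu _)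

/-- The general term of the shuffle sum. -/
def term (n : Fin k → ℤ) (br : V →ₗ[ℚ] V →ₗ[ℚ] V) (u : Finset (Fin k) → V)
    (A B : Finset (Fin k)) : V :=
  ((-1 : ℚ) ^ udeg n A * koszul n A B) • br (u A) (u B)

lemma term_symm (hG : IsGradedLie gr br) (hu : ∀ A, u A ∈ gr (udeg n A))
    {A B : Finset (Fin k)} (h : Disjoint A B) : term n br u B A = term n br u A B := by
  rw [term, term, koszul_swap n h, hG.br_anti (hu B) (hu A)]
  simp only [add_mul, mul_add, one_mul, mul_one, sign_add, sign_mul_left]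
  rcases sign_pm (udeg n A) with hp | hp <;> rcases sign_pm (udeg n B) with hq | hq <;>
    simp [hp, hq]

lemma two_shuffleSum (hG : IsGradedLie gr br) (hu : ∀ A, u A ∈ gr (udeg n A)) (h0 : u ∅ = 0)
    (S : Finset (Fin k)) :
    (2 : ℚ) • shuffleSum n br u S = ∑ A ∈ S.powerset, term n br u A (S \ A) := by
  classical
  rcases S.eq_empty_or_nonempty with rfl | hS
  · simp [shuffleSum, term, h0]
  have hmin : ∀ A ⊆ S, ((∃ m ∈ A, ∀ i ∈ S, m ≤ i) ↔ S.min' hS ∈ A) := by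
    intro A hA
    constructor
    · rintro ⟨m, hm, hmi⟩
      have : m = S.min' hS := le_antisymm (hmi _ (S.min'_mem hS)) (S.min'_le m (hA hm))
      exact this ▸ hm
    · intro h
      exact ⟨_, h, fun i hi => S.min'_le i hi⟩
  have e1 : shuffleSum n br u S =
      ∑ A ∈ S.powerset with S.min' hS ∈ A, term n br u A (S \ A) := by
    refine Finset.sum_subset_zero_on_sdiff ?_ ?_ fun _ _ => rfl
    · intro A hA
      rw [Finset.mem_filter, Finset.mem_ssubsets] at hA
      rw [Finset.mem_filter, Finset.mem_powerset]
      exact ⟨hA.1.1, (hmin A hA.1.1).1 hA.2⟩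
    · intro A hA
      rw [Finset.mem_sdiff, Finset.mem_filter, Finset.mem_powerset, Finset.mem_filter,
        Finset.mem_ssubsets] at hA
      have hAS : A = S := by
        by_contra hne
        exact hA.2 ⟨hA.1.1.ssubset_of_ne hne, (hmin A hA.1.1).2 hA.1.2⟩
      simp [term, hAS, h0]
  have e2 : ∑ A ∈ S.powerset with ¬ S.min' hS ∈ A, term n br u A (S \ A) =
      ∑ A ∈ S.powerset with S.min' hS ∈ A, term n br u A (S \ A) := by
    refine Finset.sum_nbij' (fun A => S \ A) (fun A => S \ A) ?_ ?_ ?_ ?_ ?_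
    · intro A hA
      rw [Finset.mem_filter, Finset.mem_powerset] at hA ⊢
      exact ⟨Finset.sdiff_subset, Finset.mem_sdiff.2 ⟨S.min'_mem hS, hA.2⟩⟩
    · intro A hA
      rw [Finset.mem_filter, Finset.mem_powerset] at hA ⊢
      exact ⟨Finset.sdiff_subset, fun h => (Finset.mem_sdiff.1 h).2 hA.2⟩
    · intro A hA
      exact Finset.sdiff_sdiff_eq_self (Finset.mem_powerset.1 (Finset.mem_filter.1 hA).1)
    · intro A hA
      exact Finset.sdiff_sdiff_eq_self (Finset.mem_powerset.1 (Finset.mem_filter.1 hA).1)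
    · intro A hA
      rw [Finset.sdiff_sdiff_eq_self (Finset.mem_powerset.1 (Finset.mem_filter.1 hA).1)]
      exact term_symm hG hu Finset.sdiff_disjoint
  rw [← Finset.sum_filter_add_sum_filter_not S.powerset (fun A => S.min' hS ∈ A), e2, ← e1,
    two_smul]

/-- The general term of the sum over the decompositions of a set into three parts. -/
def term₃ (n : Fin k → ℤ) (br : V →ₗ[ℚ] V →ₗ[ℚ] V) (u : Finset (Fin k) → V)
    (A B C : Finset (Fin k)) : V :=
  (koszul n A B * koszul n A C * koszul n B C * (-1 : ℚ) ^ udeg n B) • br (u A) (br (u B) (u C))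

lemma term₃_cyclic (hG : IsGradedLie gr br) (hu : ∀ A, u A ∈ gr (udeg n A))
    {A B C : Finset (Fin k)} (hAB : Disjoint A B) (hAC : Disjoint A C) (hBC : Disjoint B C) :
    term₃ n br u A B C + term₃ n br u B C A + term₃ n br u C A B = 0 := by
  rw [term₃, term₃, term₃, koszul_swap n hAB, koszul_swap n hAC, koszul_swap n hBC,
    hG.jacobi (hu A) (hu B) (hu C), hG.br_anti (hG.br_mem (hu A) (hu B)) (hu C),
    hG.br_anti (hu C) (hu A)]
  simp only [add_mul, mul_add, one_mul, mul_one, sign_add, sign_mul_left]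
  rcases sign_pm (udeg n A) with hp | hp <;> rcases sign_pm (udeg n B) with hq | hq <;>
    rcases sign_pm (udeg n C) with hr | hr <;> simp [hp, hq, hr] <;> module

/-- The sum over all the ordered decompositions of `S` into three parts. -/
def sum₃ (n : Fin k → ℤ) (br : V →ₗ[ℚ] V →ₗ[ℚ] V) (u : Finset (Fin k) → V)
    (S : Finset (Fin k)) : V :=
  ∑ p ∈ S.powerset.sigma fun A => (S \ A).powerset, term₃ n br u p.1 p.2 ((S \ p.1) \ p.2)

lemma sum₃_rotate {V : Type*} [AddCommGroup V] (f : Finset (Fin k) → Finset (Fin k) → Finset (Fin k) → V)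
    (S : Finset (Fin k)) :
    ∑ p ∈ S.powerset.sigma fun A => (S \ A).powerset, f p.1 p.2 ((S \ p.1) \ p.2) =
      ∑ p ∈ S.powerset.sigma fun A => (S \ A).powerset, f p.2 ((S \ p.1) \ p.2) p.1 := by
  refine Finset.sum_nbij' (fun p => ⟨(S \ p.1) \ p.2, p.1⟩) (fun p => ⟨p.2, (S \ p.1) \ p.2⟩)
    ?_ ?_ ?_ ?_ ?_
  · rintro ⟨A, B⟩ h
    simp only [Finset.mem_sigma, Finset.mem_powerset] at h ⊢
    refine ⟨Finset.sdiff_subset.trans Finset.sdiff_subset, fun x hx => ?_⟩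
    have := h.1 hx
    simp only [Finset.mem_sdiff]
    tauto
  · rintro ⟨A, B⟩ h
    simp only [Finset.mem_sigma, Finset.mem_powerset] at h ⊢
    refine ⟨h.2.trans Finset.sdiff_subset, fun x hx => ?_⟩
    simp only [Finset.mem_sdiff] at hx ⊢
    tauto
  · rintro ⟨A, B⟩ h
    simp only [Finset.mem_sigma, Finset.mem_powerset] at h
    have e : (S \ ((S \ A) \ B)) \ A = B := by
      ext x
      have h1 := @h.1 x
      have h2 := @h.2 x
      simp only [Finset.mem_sdiff] at h2 ⊢
      tauto
    simp only [e]
  · rintro ⟨A, B⟩ h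
    simp only [Finset.mem_sigma, Finset.mem_powerset] at h
    have e : (S \ B) \ ((S \ A) \ B) = A := by
      ext x
      have h1 := @h.1 x
      have h2 := @h.2 x
      simp only [Finset.mem_sdiff] at h2 ⊢
      tauto
    simp only [e]
  · rintro ⟨A, B⟩ h
    simp only [Finset.mem_sigma, Finset.mem_powerset] at h
    have e : (S \ ((S \ A) \ B)) \ A = B := by
      ext x
      have h1 := @h.1 x
      have h2 := @h.2 x
      simp only [Finset.mem_sdiff] at h2 ⊢
      tauto
    simp only [e]

lemma sum₃_eq_zero (hG : IsGradedLie gr br) (hu : ∀ A, u A ∈ gr (udeg n A))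
    (S : Finset (Fin k)) : sum₃ n br u S = 0 := by
  have h1 := sum₃_rotate (term₃ n br u) S
  have h2 := sum₃_rotate (fun A B C => term₃ n br u B C A) S
  have h3 : sum₃ n br u S + sum₃ n br u S + sum₃ n br u S = 0 := by
    nth_rw 3 [sum₃]
    nth_rw 2 [sum₃]
    nth_rw 1 [sum₃]
    nth_rw 3 [h1]
    rw [h2]
    nth_rw 2 [h1]
    rw [← Finset.sum_add_distrib, ← Finset.sum_add_distrib]
    refine Finset.sum_eq_zero fun p hp => ?_
    simp only [Finset.mem_sigma, Finset.mem_powerset] at hp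
    have hAB : Disjoint p.1 p.2 := Finset.disjoint_sdiff.mono_right hp.2
    have hAC : Disjoint p.1 ((S \ p.1) \ p.2) :=
      Finset.disjoint_sdiff.mono_right Finset.sdiff_subset
    have := term₃_cyclic hG hu hAB hAC Finset.disjoint_sdiff
    rw [← this]
  have h4 : (3 : ℚ) • sum₃ n br u S = 0 := by rw [← h3]; module
  exact (smul_eq_zero.1 h4).resolve_left (by norm_num)

lemma d_shuffleSum_aux (hG : IsGradedLie gr br) {d : V →ₗ[ℚ] V} (hd : IsDerivation gr br d)
    (hu : ∀ A, u A ∈ gr (udeg n A)) (h0 : u ∅ = 0) (S : Finset (Fin k))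
    (hS : ∀ A ⊂ S, A.Nonempty → d (u A) = shuffleSum n br u A) :
    d (shuffleSum n br u S) = 0 := by
  classical
  have hw : ∀ A, shuffleSum n br u A ∈ gr (udeg n A - 1) := fun A => shuffleSum_mem hG.br_mem hu
  have e1 : (2 : ℚ) • d (shuffleSum n br u S) =
      ∑ A ∈ S.powerset, ((-1 : ℚ) ^ udeg n A * koszul n A (S \ A)) •
        br (shuffleSum n br u A) (u (S \ A)) +
      ∑ A ∈ S.powerset, koszul n A (S \ A) • br (u A) (shuffleSum n br u (S \ A)) := by
    rw [← map_smul, two_shuffleSum hG hu h0, map_sum, ← Finset.sum_add_distrib]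
    refine Finset.sum_congr rfl fun A hA => ?_
    rw [Finset.mem_powerset] at hA
    have hdw : ∀ B C, B ⊆ S → (u C ≠ 0 → C.Nonempty → B ≠ S) →
        (d (u B) = shuffleSum n br u B ∨ u C = 0) := by
      intro B C hB hC
      rcases B.eq_empty_or_nonempty with rfl | hBn
      · left; simp [h0, shuffleSum]
      · by_cases hC0 : u C = 0
        · exact Or.inr hC0
        · refine Or.inl (hS B (hB.ssubset_of_ne (hC hC0 ?_)) hBn)
          rw [Finset.nonempty_iff_ne_empty]
          rintro rfl
          exact hC0 h0
    have k1 : br (d (u A)) (u (S \ A)) = br (shuffleSum n br u A) (u (S \ A)) := by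
      rcases hdw A (S \ A) hA (by rintro - h rfl; simp at h) with h | h <;> simp [h]
    have k2 : br (u A) (d (u (S \ A))) = br (u A) (shuffleSum n br u (S \ A)) := by
      rcases hdw (S \ A) A Finset.sdiff_subset (by
        rintro - ⟨x, hx⟩ h
        have := hA hx
        rw [← h, Finset.mem_sdiff] at this
        exact this.2 hx) with h | h <;> simp [h]
    rw [term, map_smul, hd.leibniz _ (hu A), k1, k2]
    rcases sign_pm (udeg n A) with hp | hp <;> simp [hp]
  have e2 : ∑ A ∈ S.powerset, ((-1 : ℚ) ^ udeg n A * koszul n A (S \ A)) •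
        br (shuffleSum n br u A) (u (S \ A)) =
      ∑ A ∈ S.powerset, koszul n A (S \ A) • br (u A) (shuffleSum n br u (S \ A)) := by
    refine Finset.sum_nbij' (fun A => S \ A) (fun A => S \ A)
      (fun A _ => by simp) (fun A _ => by simp)
      (fun A hA => Finset.sdiff_sdiff_eq_self (Finset.mem_powerset.1 hA))
      (fun A hA => Finset.sdiff_sdiff_eq_self (Finset.mem_powerset.1 hA)) fun A hA => ?_
    rw [Finset.sdiff_sdiff_eq_self (Finset.mem_powerset.1 hA),
      koszul_swap n (A := A) Finset.disjoint_sdiff, hG.br_anti (hw A) (hu (S \ A))]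
    simp only [add_mul, mul_add, sub_mul, one_mul, mul_one, sign_add, sign_mul_left, zpow_sub₀ (show (-1 : ℚ) ≠ 0 by norm_num)]
    rcases sign_pm (udeg n A) with hp | hp <;> rcases sign_pm (udeg n (S \ A)) with hq | hq <;>
      simp [hp, hq]
  have e3 : (2 : ℚ) • ∑ A ∈ S.powerset,
      koszul n A (S \ A) • br (u A) (shuffleSum n br u (S \ A)) = sum₃ n br u S := by
    rw [sum₃, Finset.sum_sigma, Finset.smul_sum]
    refine Finset.sum_congr rfl fun A hA => ?_
    rw [smul_comm, ← map_smul, two_shuffleSum hG hu h0, map_sum, Finset.smul_sum]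
    refine Finset.sum_congr rfl fun B hB => ?_
    rw [Finset.mem_powerset] at hB
    have hk := koszul_union_right n (A := A) (B := B) (C := (S \ A) \ B) Finset.disjoint_sdiff
    rw [Finset.union_sdiff_of_subset hB] at hk
    rw [term, term₃, map_smul, smul_smul, hk]
    congr 1
    ring
  rw [e2, ← two_smul ℚ, e3, sum₃_eq_zero hG hu] at e1
  exact (smul_eq_zero.1 e1).resolve_left (by norm_num)

/-- If `∂ u_A` is the shuffle sum for all nonempty proper subsets `A` of `S`, then the
shuffle sum for `S` is a cycle. -/
lemma d_shuffleSum (hG : IsGradedLie gr br) {d : V →ₗ[ℚ] V} (hd : IsDerivation gr br d)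
    (hu : ∀ A, A.Nonempty → u A ∈ gr (udeg n A)) (S : Finset (Fin k))
    (hS : ∀ A ⊂ S, A.Nonempty → d (u A) = shuffleSum n br u A) :
    d (shuffleSum n br u S) = 0 := by
  classical
  let u' : Finset (Fin k) → V := fun A => if A.Nonempty then u A else 0
  have hu' : ∀ A, A.Nonempty → u' A = u A := fun A hA => if_pos hA
  have h0 : u' ∅ = 0 := if_neg (by simp)
  have hw : ∀ T, shuffleSum n br u' T = shuffleSum n br u T := by
    intro T
    refine Finset.sum_congr rfl fun A hA => ?_
    rw [Finset.mem_filter, Finset.mem_ssubsets] at hA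
    obtain ⟨hA, m, hm, -⟩ := hA
    rw [hu' A ⟨m, hm⟩, hu' (T \ A) (Finset.sdiff_nonempty.2 hA.2)]
  rw [← hw]
  refine d_shuffleSum_aux hG hd (fun A => ?_) h0 S fun A hA hAn => ?_
  · rcases A.eq_empty_or_nonempty with rfl | hA
    · rw [h0]; exact Submodule.zero_mem _
    · rw [hu' A hA]; exact hu A hA
  · rw [hu' A hAn, hw, hS A hA hAn]

end identity

lemma genNA_mem (n : Fin k → ℤ) (S : Finset (Fin k)) :
    genNA S ∈ FreeGradedLie.grNA (deg n) (udeg n S) := by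
  rw [genNA]
  split_ifs with h
  · exact FreeGradedLie.mon_mem (deg n) (.of (⟨S, h⟩ : Index k))
  · exact Submodule.zero_mem _

lemma δ_mem (n : Fin k → ℤ) (S : Index k) : δ n S ∈ FreeGradedLie.grNA (deg n) (deg n S - 1) :=
  shuffleSum_mem FreeGradedLie.mulNA_mem_grNA (genNA_mem n)

/-- The generator `u_S` in the free graded Lie algebra, for `S` nonempty and proper. -/
noncomputable def gen (n : Fin k → ℤ) (S : Finset (Fin k)) : FreeGradedLie.Carrier (deg n) :=
  (FreeGradedLie.relIdeal (deg n)).mkQ (genNA S)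

lemma gen_eq (n : Fin k → ℤ) (S : Index k) : gen n S.1 = FreeGradedLie.gen (deg n) S := by
  rw [gen, genNA, dif_pos S.2, FreeGradedLie.gen]

lemma gen_mem (n : Fin k → ℤ) (S : Finset (Fin k)) :
    gen n S ∈ FreeGradedLie.gr (deg n) (udeg n S) := ⟨_, genNA_mem n S, rfl⟩

lemma mkQ_δ (n : Fin k → ℤ) (S : Index k) : (FreeGradedLie.relIdeal (deg n)).mkQ (δ n S) =
    shuffleSum n (FreeGradedLie.br (deg n)) (gen n) S.1 := by
  rw [δ, shuffleSum, map_sum]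
  rfl

lemma der_gen (n : Fin k → ℤ) {S : Finset (Fin k)} (hS : S.Nonempty) (hS' : S ≠ Finset.univ) :
    FreeGradedLie.der (deg n) (δ n) (δ_mem n) (gen n S) =
      shuffleSum n (FreeGradedLie.br (deg n)) (gen n) S := by
  rw [gen_eq n ⟨S, hS, hS'⟩, FreeGradedLie.der_gen, mkQ_δ]

lemma der_shuffleSum (n : Fin k → ℤ) (S : Finset (Fin k)) :
    FreeGradedLie.der (deg n) (δ n) (δ_mem n)
      (shuffleSum n (FreeGradedLie.br (deg n)) (gen n) S) = 0 :=
  d_shuffleSum (FreeGradedLie.isGradedLie _) (FreeGradedLie.isDerivation _ _ _)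
    (fun A _ => gen_mem n A) S fun _ hA hAn =>
      der_gen n hAn (hA.trans_subset (Finset.subset_univ S)).ne

/-- The differential graded Lie algebra `Lie(U)`: the free graded Lie algebra on the generators
`u_S`, for `S` a nonempty proper subset of `Fin k`, of degree `∑ i ∈ S, n i - 1`, with differential
`∂ u_S = ∑ (-1)^{|u_A|} ε(A, B) [u_A, u_B]`. -/
noncomputable def LieU (n : Fin k → ℤ) : DGLie :=
  freeDGLie (deg n) (δ n) (δ_mem n) fun S => by
    rw [FreeGradedLie.der_gen, mkQ_δ]
    exact der_shuffleSum n S.1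

/-- The generator `u_S` of `Lie(U)`, for `S` nonempty and proper. -/
noncomputable def u (n : Fin k → ℤ) (S : Finset (Fin k)) : (LieU n).carrier := gen n S

/-- The element `w = ∑ (-1)^{|u_A|} ε(A, B) [u_A, u_B]` of `Lie(U)`, the sum being over
the decompositions of the whole set `Fin k`. -/
noncomputable def w (n : Fin k → ℤ) : (LieU n).carrier :=
  shuffleSum n (LieU n).br (u n) Finset.univ

lemma d_u (n : Fin k → ℤ) {S : Finset (Fin k)} (hS : S.Nonempty) (hS' : S ≠ Finset.univ) :
    (LieU n).d (u n S) = shuffleSum n (LieU n).br (u n) S := der_gen n hS hS'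

lemma d_u_singleton (n : Fin k → ℤ) (i : Fin k) : (LieU n).d (u n {i}) = 0 := by
  by_cases h : ({i} : Finset (Fin k)) = Finset.univ
  · have : u n {i} = 0 := by
      change (FreeGradedLie.relIdeal (deg n)).mkQ (genNA {i}) = 0
      rw [genNA, dif_neg (fun h' => h'.2 h), map_zero]
    rw [this, map_zero]
  · rw [d_u n (Finset.singleton_nonempty i) h, shuffleSum]
    refine Finset.sum_eq_zero fun A hA => ?_
    rw [Finset.mem_filter, Finset.mem_ssubsets, Finset.ssubset_singleton_iff] at hA
    obtain ⟨rfl, m, hm, -⟩ := hA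
    exact absurd hm (Finset.notMem_empty m)

lemma u_singleton_mem (n : Fin k → ℤ) (i : Fin k) : u n {i} ∈ (LieU n).gr (n i - 1) := by
  have h := gen_mem n {i}
  rwa [udeg, Finset.sum_singleton] at h

lemma d_w (n : Fin k → ℤ) : (LieU n).d (w n) = 0 := der_shuffleSum n Finset.univ

lemma w_mem (n : Fin k → ℤ) : w n ∈ (LieU n).gr (∑ i, n i - 2) := by
  have h := shuffleSum_mem (gr := (LieU n).gr) (br := (LieU n).br) (n := n) (u := u n)
    (S := Finset.univ) (fun hx hy => (LieU n).isGradedLie.br_mem hx hy) (gen_mem n)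
  rwa [udeg, sub_sub, one_add_one_eq_two] at h

/-- The homology class of the cycle `u_i` of `Lie(U)`. -/
noncomputable def uClass (n : Fin k → ℤ) (i : Fin k) : (LieU n).H (n i - 1) :=
  (LieU n).cls (u n {i}) (d_u_singleton n i) (u_singleton_mem n i)

/-- The homology class of the cycle `w` of `Lie(U)`. -/
noncomputable def wClass (n : Fin k → ℤ) : (LieU n).H (∑ i, n i - 2) :=
  (LieU n).cls (w n) (d_w n) (w_mem n)

end FatWedge

/-- The higher order Whitehead bracket set `[x_1, …, x_k]`: the homology classes of `Φ(w)`, for all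
the morphisms `Φ : Lie(U) → L` such that `Φ(u_i)` represents `x_i` for all `i`. -/
def whiteheadBracket {k : ℕ} {n : Fin k → ℤ} (L : DGLie) (x : ∀ i, L.H (n i - 1)) :
    Set (L.H (∑ i, n i - 2)) :=
  {y | ∃ Φ : DGLie.Hom (FatWedge.LieU n) L,
    (∀ i, Φ.mapH (n i - 1) (FatWedge.uClass n i) = x i) ∧
      Φ.mapH (∑ i, n i - 2) (FatWedge.wClass n) = y}

/-!
`Lie(U)` is free as a graded Lie algebra and the differential of each generator `u_S` is a
polynomial in the `u_A` with `A ⊂ S`. Choosing the images of the generators inductively, one lifts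
every morphism from `Lie(U)` strictly along an acyclic fibration. A quasi-isomorphism `φ : L → L'`
is replaced by acyclic fibrations through its mapping path object `P = L ×_{L'} (L' ⊗ ℚ[t, dt])`:
both the source `P → L` and the target `P → L'` are acyclic fibrations, and in homology the target
is `φ` after the source. Hence a morphism `Lie(U) → L'` lifts to `P`, and the image of the lift
in `L` realises the same homology classes up to the isomorphism `φ_*`.
-/

universe w

open scoped TensorProduct Polynomial

section InternalGrading

open DirectSum

variable {ι R V W : Type*} [DecidableEq ι] [Ring R] [AddCommGroup V] [Module R V]
  [AddCommGroup W] [Module R W] {g : ι → Submodule R V} {g' : ι → Submodule R W}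

lemma isInternal_comp_equiv {κ : Type*} [DecidableEq κ] (hg : IsInternal g) (e : κ ≃ ι) :
    IsInternal fun j => g (e j) := by
  rw [isInternal_submodule_iff_iSupIndep_and_iSup_eq_top]
  exact ⟨hg.submodule_iSupIndep.comp e.injective,
    (e.iSup_comp (g := g)).trans hg.submodule_iSup_eq_top⟩

lemma isInternal_prod (hg : IsInternal g) (hg' : IsInternal g') :
    IsInternal fun i => (g i).prod (g' i) := by
  rw [isInternal_submodule_iff_iSupIndep_and_iSup_eq_top]
  refine ⟨fun i => ?_, ?_⟩
  · have hle : ⨆ j, ⨆ (_ : j ≠ i), (g j).prod (g' j) ≤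
        (⨆ j, ⨆ (_ : j ≠ i), g j).prod (⨆ j, ⨆ (_ : j ≠ i), g' j) :=
      iSup₂_le fun j hj => Submodule.prod_mono (le_iSup₂_of_le j hj le_rfl)
        (le_iSup₂_of_le j hj le_rfl)
    refine Disjoint.mono_right hle ?_
    rw [disjoint_iff, Submodule.prod_inf_prod, (hg.submodule_iSupIndep i).eq_bot,
      (hg'.submodule_iSupIndep i).eq_bot, Submodule.prod_bot]
  · simp_rw [LinearMap.prod_eq_sup_map, iSup_sup_eq, ← Submodule.map_iSup,
      hg.submodule_iSup_eq_top, hg'.submodule_iSup_eq_top, ← LinearMap.prod_eq_sup_map,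
      Submodule.prod_top]

lemma isInternal_comap_subtype [Decomposition g] {S : Submodule R V}
    (hS : SetLike.IsHomogeneous g S) : IsInternal fun i => (g i).comap S.subtype := by
  classical
  have hg := Decomposition.isInternal g
  rw [isInternal_submodule_iff_iSupIndep_and_iSup_eq_top]
  refine ⟨fun i => Submodule.disjoint_def.2 fun x hx hx' => ?_, eq_top_iff.2 fun x _ => ?_⟩
  · have hle : ⨆ j, ⨆ (_ : j ≠ i), (g j).comap S.subtype ≤
        (⨆ j, ⨆ (_ : j ≠ i), g j).comap S.subtype :=
      iSup₂_le fun j hj => Submodule.comap_mono (le_iSup₂_of_le j hj le_rfl)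
    exact Subtype.ext (Submodule.disjoint_def.1 (hg.submodule_iSupIndep i) x hx (hle hx'))
  · have hx : x = ∑ i ∈ (decompose g (x : V)).support, ⟨decompose g (x : V) i, hS i x.2⟩ :=
      Subtype.ext <| by
        rw [AddSubmonoidClass.coe_finsetSum]
        exact (sum_support_decompose g (x : V)).symm
    rw [hx]
    exact sum_mem fun i _ => Submodule.mem_iSup_of_mem i (decompose g (x : V) i).2

lemma map_decompose [Decomposition g] [Decomposition g'] {f : V →ₗ[R] W}
    (hf : ∀ i, g i ≤ (g' i).comap f) (x : V) (i : ι) :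
    f (decompose g x i) = decompose g' (f x) i := by
  induction x using Decomposition.inductionOn g with
  | zero => simp
  | add x y hx hy => simp [hx, hy]
  | @homogeneous j m =>
    obtain rfl | hij := eq_or_ne j i
    · rw [decompose_of_mem_same g m.2, decompose_of_mem_same g' (hf j m.2)]
    · rw [decompose_of_mem_ne g m.2 hij, decompose_of_mem_ne g' (hf j m.2) hij, map_zero]

lemma isInternal_comap_eqLocus (hg : IsInternal g) (hg' : IsInternal g') {f f' : V →ₗ[R] W}
    (hf : ∀ i, g i ≤ (g' i).comap f) (hf' : ∀ i, g i ≤ (g' i).comap f') :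
    IsInternal fun i => (g i).comap (LinearMap.eqLocus f f').subtype := by
  let _ := hg.chooseDecomposition
  let _ := hg'.chooseDecomposition
  refine isInternal_comap_subtype fun i x hx => ?_
  rw [LinearMap.mem_eqLocus] at hx ⊢
  rw [map_decompose hf, map_decompose hf', hx]

end InternalGrading

section Sign

open DirectSum

variable {V : Type*} [AddCommGroup V] [Module ℚ V] {g : ℤ → Submodule ℚ V}

/-- The sign operator `x ↦ (-1)^{|x|} x` of a graded vector space. -/
noncomputable def signOp (h : IsInternal g) : V →ₗ[ℚ] V :=
  (toModule ℚ ℤ V fun n => (-1 : ℚ) ^ n • (g n).subtype) ∘ₗ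
    (LinearEquiv.ofBijective (coeLinearMap g) h).symm.toLinearMap

lemma signOp_apply (h : IsInternal g) {n : ℤ} {x : V} (hx : x ∈ g n) :
    signOp h x = (-1 : ℚ) ^ n • x := by
  have hx' : (LinearEquiv.ofBijective (coeLinearMap g) h).symm x =
      lof ℚ ℤ (fun n => g n) n ⟨x, hx⟩ :=
    (LinearEquiv.symm_apply_eq _).2 (coeLinearMap_lof g n ⟨x, hx⟩).symm
  simp [signOp, hx']

end Sign

section ExtensionOfScalars

open DirectSum (IsInternal decomposeTensor)

variable {V A : Type*} [AddCommGroup V] [Module ℚ V] [CommRing A] [Algebra ℚ A]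
  {g : ℤ → Submodule ℚ V} {b : V →ₗ[ℚ] V →ₗ[ℚ] V} {d : V →ₗ[ℚ] V}

lemma isInternal_decomposeTensor (hg : IsInternal g) : IsInternal (decomposeTensor g A) := by
  let _ := hg.chooseDecomposition
  let _ := DirectSum.tensorDecomposition g A
  exact DirectSum.Decomposition.isInternal _

lemma tmul_mem_decomposeTensor {n : ℤ} {x : V} (hx : x ∈ g n) (a : A) :
    x ⊗ₜ[ℚ] a ∈ decomposeTensor g A n :=
  ⟨⟨x, hx⟩ ⊗ₜ a, rfl⟩

@[elab_as_elim]
lemma decomposeTensor_induction {n : ℤ} {p : ∀ x : V ⊗[ℚ] A, x ∈ decomposeTensor g A n → Prop}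
    (tmul : ∀ x (hx : x ∈ g n) (a : A), p (x ⊗ₜ a) (tmul_mem_decomposeTensor hx a))
    (add : ∀ x y hx hy, p x hx → p y hy → p (x + y) (add_mem hx hy))
    {x : V ⊗[ℚ] A} (hx : x ∈ decomposeTensor g A n) : p x hx := by
  obtain ⟨t, rfl⟩ := hx
  induction t with
  | zero => simpa using tmul 0 (zero_mem _) 0
  | tmul x a => exact tmul x x.2 a
  | add s t hs ht => simpa only [map_add] using add _ _ _ _ hs ht

lemma rTensor_mem_decomposeTensor {W : Type*} [AddCommGroup W] [Module ℚ W]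
    {g' : ℤ → Submodule ℚ W} {f : V →ₗ[ℚ] W} {n m : ℤ} (hf : ∀ {x}, x ∈ g n → f x ∈ g' m)
    {x : V ⊗[ℚ] A} (hx : x ∈ decomposeTensor g A n) :
    f.rTensor A x ∈ decomposeTensor g' A m := by
  induction hx using decomposeTensor_induction with
  | tmul x hx a => exact tmul_mem_decomposeTensor (hf hx) a
  | add x y _ _ hx hy => rw [map_add]; exact add_mem hx hy

lemma lTensor_mem_decomposeTensor {B : Type*} [CommRing B] [Algebra ℚ B] (f : A →ₗ[ℚ] B) {n : ℤ}
    {x : V ⊗[ℚ] A} (hx : x ∈ decomposeTensor g A n) :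
    f.lTensor V x ∈ decomposeTensor g B n := by
  induction hx using decomposeTensor_induction with
  | tmul x hx a => exact tmul_mem_decomposeTensor hx (f a)
  | add x y _ _ hx hy => rw [map_add]; exact add_mem hx hy

/-- The bracket `[x ⊗ a, y ⊗ a'] = [x, y] ⊗ a a'` of the extension of scalars `V ⊗ A` of a Lie
algebra `V` to a commutative algebra `A`. -/
noncomputable def tensorBr (A : Type*) [CommRing A] [Algebra ℚ A] (b : V →ₗ[ℚ] V →ₗ[ℚ] V) :
    V ⊗[ℚ] A →ₗ[ℚ] V ⊗[ℚ] A →ₗ[ℚ] V ⊗[ℚ] A :=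
  TensorProduct.map₂ b (LinearMap.mul ℚ A)

lemma tensorBr_tmul (b : V →ₗ[ℚ] V →ₗ[ℚ] V) (x y : V) (a a' : A) :
    tensorBr A b (x ⊗ₜ a) (y ⊗ₜ a') = b x y ⊗ₜ (a * a') := rfl

lemma isGradedLie_tensor (h : IsGradedLie g b) :
    IsGradedLie (decomposeTensor g A) (tensorBr A b) where
  internal := isInternal_decomposeTensor h.internal
  br_mem {i j x y} hx hy := by
    induction hx using decomposeTensor_induction with
    | add x x' _ _ hx hx' => rw [map_add, LinearMap.add_apply]; exact add_mem hx hx'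
    | tmul x hx a =>
      induction hy using decomposeTensor_induction with
      | add y y' _ _ hy hy' => rw [map_add]; exact add_mem hy hy'
      | tmul y hy a' => exact tmul_mem_decomposeTensor (h.br_mem hx hy) _
  br_anti {i j x y} hx hy := by
    induction hx using decomposeTensor_induction with
    | add x x' _ _ hx hx' => rw [map_add, LinearMap.add_apply, hx, hx', map_add]; module
    | tmul x hx a =>
      induction hy using decomposeTensor_induction with
      | add y y' _ _ hy hy' => rw [map_add, hy, hy', map_add, LinearMap.add_apply]; module
      | tmul y hy a' =>
        rw [tensorBr_tmul, tensorBr_tmul, h.br_anti hx hy, mul_comm a', TensorProduct.neg_tmul,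
          TensorProduct.smul_tmul']
  jacobi {i j l x y z} hx hy hz := by
    induction hx using decomposeTensor_induction with
    | add x x' _ _ hx hx' => simp only [map_add, LinearMap.add_apply, hx, hx']; module
    | tmul x hx a =>
      induction hy using decomposeTensor_induction with
      | add y y' _ _ hy hy' => simp only [map_add, LinearMap.add_apply, hy, hy']; module
      | tmul y hy a' =>
        induction hz using decomposeTensor_induction with
        | add z z' _ _ hz hz' => simp only [map_add, hz, hz']; module
        | tmul z hz a'' =>
          simp only [tensorBr_tmul]
          rw [h.jacobi hx hy hz, TensorProduct.add_tmul, TensorProduct.smul_tmul', mul_assoc,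
            mul_left_comm a']

lemma isDerivation_rTensor (h : IsDerivation g b d) :
    IsDerivation (decomposeTensor g A) (tensorBr A b) (d.rTensor A) where
  d_mem := rTensor_mem_decomposeTensor h.d_mem
  leibniz {i x} y hx := by
    induction hx using decomposeTensor_induction with
    | add x x' _ _ hx hx' => simp only [map_add, LinearMap.add_apply, hx, hx']; module
    | tmul x hx a =>
      induction y with
      | zero => simp only [map_zero, smul_zero, add_zero]
      | add y y' hy hy' => simp only [map_add, hy, hy']; module
      | tmul y a' =>
        simp only [tensorBr_tmul, LinearMap.rTensor_tmul]
        rw [h.leibniz y hx, TensorProduct.add_tmul, TensorProduct.smul_tmul']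

lemma lTensor_tensorBr {D : A →ₗ[ℚ] A} (hD : ∀ a a', D (a * a') = D a * a' + a * D a')
    (b : V →ₗ[ℚ] V →ₗ[ℚ] V) (x y : V ⊗[ℚ] A) :
    D.lTensor V (tensorBr A b x y) =
      tensorBr A b (D.lTensor V x) y + tensorBr A b x (D.lTensor V y) := by
  induction x with
  | zero => simp only [map_zero, LinearMap.zero_apply, add_zero]
  | add x x' hx hx' => simp only [map_add, LinearMap.add_apply, hx, hx']; abel
  | tmul x a =>
    induction y with
    | zero => simp only [map_zero, add_zero]
    | add y y' hy hy' => simp only [map_add, hy, hy']; abel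
    | tmul y a' => simp only [tensorBr_tmul, LinearMap.lTensor_tmul, hD, TensorProduct.tmul_add]

end ExtensionOfScalars

namespace DtExtension

open DirectSum (IsInternal)
open FreeGradedLie (sign_pm sign_add sign_sub_one sign_mul_left)

variable {V : Type*} [AddCommGroup V] [Module ℚ V]

/-- The elements `a + dt b` of degree `n` of `V ⊕ dt V`, the degree of `dt` being `-1`. -/
def gr (g : ℤ → Submodule ℚ V) (n : ℤ) : Submodule ℚ (V × V) := (g n).prod (g (n + 1))

/-- The bracket `[a + dt b, a' + dt b'] = [a, a'] + dt ([b, a'] + (-1)^{|a|} [a, b'])` of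
`V ⊕ dt V`, where `σ` stands for the sign operator `a ↦ (-1)^{|a|} a`. -/
noncomputable def br (σ : V →ₗ[ℚ] V) (b : V →ₗ[ℚ] V →ₗ[ℚ] V) : V × V →ₗ[ℚ] V × V →ₗ[ℚ] V × V :=
  LinearMap.mk₂ ℚ (fun x y => (b x.1 y.1, b x.2 y.1 + b (σ x.1) y.2))
    (fun x y z => by
      simp only [Prod.fst_add, Prod.snd_add, map_add, LinearMap.add_apply, Prod.mk_add_mk,
        add_add_add_comm])
    (fun c x y => by simp)
    (fun x y z => by
      simp only [Prod.fst_add, Prod.snd_add, map_add, Prod.mk_add_mk, add_add_add_comm])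
    (fun c x y => by simp)

lemma br_apply (σ : V →ₗ[ℚ] V) (b : V →ₗ[ℚ] V →ₗ[ℚ] V) (x y : V × V) :
    br σ b x y = (b x.1 y.1, b x.2 y.1 + b (σ x.1) y.2) := rfl

/-- The differential `a + dt b ↦ d a + dt (D a - d b)` of `V ⊕ dt V`, where `d` is the differential
of `V` and `D` stands for the derivative with respect to `t`. -/
def diff (d D : V →ₗ[ℚ] V) : V × V →ₗ[ℚ] V × V :=
  (d ∘ₗ LinearMap.fst ℚ V V).prod (D ∘ₗ LinearMap.fst ℚ V V - d ∘ₗ LinearMap.snd ℚ V V)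

lemma diff_apply (d D : V →ₗ[ℚ] V) (x : V × V) : diff d D x = (d x.1, D x.1 - d x.2) := rfl

lemma diff_diff {d D : V →ₗ[ℚ] V} (hd : ∀ x, d (d x) = 0) (hdD : ∀ x, d (D x) = D (d x))
    (x : V × V) : diff d D (diff d D x) = 0 := by
  simp [diff_apply, hd, hdD]

variable {g : ℤ → Submodule ℚ V} {b : V →ₗ[ℚ] V →ₗ[ℚ] V} {d D : V →ₗ[ℚ] V}

lemma isInternal (hg : IsInternal g) : IsInternal (gr g) :=
  isInternal_prod hg (isInternal_comp_equiv hg (Equiv.addRight 1))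

lemma isGradedLie (h : IsGradedLie g b) : IsGradedLie (gr g) (br (signOp h.internal) b) where
  internal := isInternal h.internal
  br_mem := by
    rintro i j ⟨x, x'⟩ ⟨y, y'⟩ ⟨hx, hx'⟩ ⟨hy, hy'⟩
    dsimp only at hx hx' hy hy'
    have hx'y := h.br_mem hx' hy
    have hxy' := h.br_mem hx hy'
    rw [add_right_comm] at hx'y
    rw [← add_assoc] at hxy'
    refine ⟨h.br_mem hx hy, Submodule.add_mem _ hx'y ?_⟩
    rw [signOp_apply h.internal hx, map_smul]
    exact Submodule.smul_mem _ _ hxy'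
  br_anti := by
    rintro i j ⟨x, x'⟩ ⟨y, y'⟩ ⟨hx, hx'⟩ ⟨hy, hy'⟩
    dsimp only at hx hx' hy hy'
    rw [br_apply, br_apply, signOp_apply h.internal hx, signOp_apply h.internal hy]
    refine Prod.ext (h.br_anti hx hy) ?_
    simp only [Prod.snd_neg, Prod.smul_snd, map_smul, LinearMap.smul_apply]
    rw [h.br_anti hx' hy, h.br_anti hx hy']
    simp only [add_mul, mul_add, one_mul, mul_one, sign_add, sign_mul_left]
    rcases sign_pm i with hi | hi <;> rcases sign_pm j with hj | hj <;> rw [hi, hj] <;> simp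
  jacobi := by
    rintro i j l ⟨x, x'⟩ ⟨y, y'⟩ ⟨z, z'⟩ ⟨hx, hx'⟩ ⟨hy, hy'⟩ ⟨hz, hz'⟩
    dsimp only at hx hx' hy hy' hz hz'
    simp only [br_apply]
    rw [signOp_apply h.internal hx, signOp_apply h.internal hy,
      signOp_apply h.internal (h.br_mem hx hy)]
    refine Prod.ext (h.jacobi hx hy hz) ?_
    simp only [Prod.snd_add, Prod.smul_snd, map_smul, map_add, LinearMap.smul_apply,
      LinearMap.add_apply]
    rw [h.jacobi hx' hy hz, h.jacobi hx hy' hz, h.jacobi hx hy hz']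
    simp only [add_mul, mul_add, one_mul, mul_one, sign_add, sign_mul_left]
    rcases sign_pm i with hi | hi <;> rcases sign_pm j with hj | hj <;> simp [hi, hj] <;> abel

lemma isDerivation (h : IsGradedLie g b) (hd : IsDerivation g b d)
    (hD : ∀ {n x}, x ∈ g n → D x ∈ g n) (hDb : ∀ x y, D (b x y) = b (D x) y + b x (D y)) :
    IsDerivation (gr g) (br (signOp h.internal) b) (diff d D) where
  d_mem := by
    rintro i ⟨x, x'⟩ ⟨hx, hx'⟩
    have hDx : D x ∈ g (i - 1 + 1) := by rw [sub_add_cancel]; exact hD hx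
    have hdx' : d x' ∈ g (i - 1 + 1) := by rw [← add_sub_right_comm]; exact hd.d_mem hx'
    exact ⟨hd.d_mem hx, Submodule.sub_mem _ hDx hdx'⟩
  leibniz := by
    rintro i ⟨x, x'⟩ ⟨y, y'⟩ ⟨hx, hx'⟩
    dsimp only at hx hx'
    simp only [br_apply, diff_apply]
    rw [signOp_apply h.internal hx, signOp_apply h.internal (hd.d_mem hx)]
    refine Prod.ext (hd.leibniz y hx) ?_
    simp only [Prod.snd_add, Prod.smul_snd, map_smul, map_add, LinearMap.smul_apply, map_sub,
      LinearMap.sub_apply]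
    rw [hd.leibniz _ hx, hd.leibniz _ hx', hDb, sign_add, sign_sub_one]
    rcases sign_pm i with hi | hi <;> simp [hi] <;> abel

end DtExtension

section PolynomialPaths

open Polynomial
open DirectSum (decomposeTensor)

/-- The antiderivative of a polynomial that vanishes at `0`. -/
noncomputable def antideriv : ℚ[X] →ₗ[ℚ] ℚ[X] :=
  Polynomial.lsum fun i => (i + 1 : ℚ)⁻¹ • monomial (i + 1)

lemma antideriv_monomial (i : ℕ) (c : ℚ) :
    antideriv (monomial i c) = (i + 1 : ℚ)⁻¹ • monomial (i + 1) c := by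
  simp [antideriv]

lemma derivative_comp_antideriv : derivative ∘ₗ antideriv = LinearMap.id := by
  refine lhom_ext' fun i => LinearMap.ext_ring ?_
  have hi : (i + 1 : ℚ) ≠ 0 := by positivity
  simp [antideriv_monomial, smul_monomial, hi]

lemma antideriv_comp_derivative :
    antideriv ∘ₗ derivative = LinearMap.id - Algebra.linearMap ℚ ℚ[X] ∘ₗ leval 0 := by
  refine lhom_ext' fun i => LinearMap.ext_ring ?_
  rcases i with _ | i
  · simp [leval]
  · have hi : (i + 1 : ℚ) ≠ 0 := by positivity
    have hderiv : derivative (monomial (i + 1) (1 : ℚ)) = monomial i (i + 1 : ℚ) := by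
      rw [derivative_monomial_succ, one_mul]
    simp only [LinearMap.comp_apply, hderiv, antideriv_monomial, smul_monomial]
    simp [leval, hi]

lemma leval_zero_comp_antideriv : leval 0 ∘ₗ antideriv = 0 := by
  refine lhom_ext' fun i => LinearMap.ext_ring ?_
  simp [antideriv_monomial, leval]

variable {V : Type*} [AddCommGroup V] [Module ℚ V]

/-- Evaluation at `c` of a polynomial with coefficients in `V`. -/
noncomputable def evalAt (c : ℚ) : V ⊗[ℚ] ℚ[X] →ₗ[ℚ] V :=
  (TensorProduct.rid ℚ V).toLinearMap ∘ₗ (leval c).lTensor V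

lemma evalAt_tmul (c : ℚ) (x : V) (p : ℚ[X]) : evalAt c (x ⊗ₜ[ℚ] p) = p.eval c • x := by
  simp [evalAt, leval]

lemma evalAt_mem {g : ℤ → Submodule ℚ V} {n : ℤ} (c : ℚ) {x : V ⊗[ℚ] ℚ[X]}
    (hx : x ∈ decomposeTensor g ℚ[X] n) : evalAt c x ∈ g n := by
  induction hx using decomposeTensor_induction with
  | tmul x hx p => rw [evalAt_tmul]; exact Submodule.smul_mem _ _ hx
  | add x y _ _ hx hy => rw [map_add]; exact add_mem hx hy

lemma evalAt_tensorBr (c : ℚ) (b : V →ₗ[ℚ] V →ₗ[ℚ] V) (x y : V ⊗[ℚ] ℚ[X]) :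
    evalAt c (tensorBr ℚ[X] b x y) = b (evalAt c x) (evalAt c y) := by
  have h : (tensorBr ℚ[X] b).compr₂ (evalAt c) = b.compl₁₂ (evalAt c) (evalAt c) :=
    TensorProduct.ext' fun x p => TensorProduct.ext' fun y q => by
      simp [tensorBr_tmul, evalAt_tmul, smul_smul, mul_comm]
  exact LinearMap.congr_fun₂ h x y

lemma evalAt_rTensor (c : ℚ) (d : V →ₗ[ℚ] V) (x : V ⊗[ℚ] ℚ[X]) :
    evalAt c (d.rTensor ℚ[X] x) = d (evalAt c x) := by
  have h : evalAt c ∘ₗ d.rTensor ℚ[X] = d ∘ₗ evalAt c :=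
    TensorProduct.ext' fun x p => by simp [evalAt_tmul]
  exact LinearMap.congr_fun h x

lemma rTensor_lTensor_comm {W : Type*} [AddCommGroup W] [Module ℚ W] (d : V →ₗ[ℚ] V)
    (f : W →ₗ[ℚ] W) (x : V ⊗[ℚ] W) :
    d.rTensor W (f.lTensor V x) = f.lTensor V (d.rTensor W x) := by
  rw [← LinearMap.comp_apply, ← LinearMap.comp_apply, LinearMap.rTensor_comp_lTensor,
    LinearMap.lTensor_comp_rTensor]

lemma derivative_antideriv_lTensor (x : V ⊗[ℚ] ℚ[X]) :
    derivative.lTensor V (antideriv.lTensor V x) = x := by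
  rw [← LinearMap.lTensor_comp_apply, derivative_comp_antideriv, LinearMap.lTensor_id_apply]

lemma antideriv_derivative_lTensor (x : V ⊗[ℚ] ℚ[X]) :
    antideriv.lTensor V (derivative.lTensor V x) = x - evalAt 0 x ⊗ₜ 1 := by
  rw [← LinearMap.lTensor_comp_apply, antideriv_comp_derivative, LinearMap.lTensor_sub,
    LinearMap.sub_apply, LinearMap.lTensor_id_apply]
  congr 1
  have h : (Algebra.linearMap ℚ ℚ[X] ∘ₗ leval 0).lTensor V =
      (TensorProduct.mk ℚ V ℚ[X]).flip 1 ∘ₗ evalAt 0 :=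
    TensorProduct.ext' fun x p => by
      simp [evalAt_tmul, leval, ← TensorProduct.tmul_smul, Polynomial.smul_eq_C_mul]
  exact LinearMap.congr_fun h x

lemma evalAt_zero_antideriv (x : V ⊗[ℚ] ℚ[X]) : evalAt 0 (antideriv.lTensor V x) = 0 := by
  rw [evalAt, LinearMap.comp_apply, ← LinearMap.lTensor_comp_apply, leval_zero_comp_antideriv,
    LinearMap.lTensor_zero, LinearMap.zero_apply, map_zero]

end PolynomialPaths

namespace DGLie

section Homology

variable {L : DGLie.{u}} {M : DGLie.{v}} {N : DGLie.{w}}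

lemma cls_eq_cls_iff {n : ℤ} {z z' : L.carrier} (hd : L.d z = 0) (hz : z ∈ L.gr n)
    (hd' : L.d z' = 0) (hz' : z' ∈ L.gr n) :
    L.cls z hd hz = L.cls z' hd' hz' ↔ ∃ e ∈ L.gr (n + 1), L.d e = z - z' :=
  Submodule.Quotient.eq _

lemma cls_eq_zero_iff {n : ℤ} {z : L.carrier} (hd : L.d z = 0) (hz : z ∈ L.gr n) :
    L.cls z hd hz = 0 ↔ ∃ e ∈ L.gr (n + 1), L.d e = z :=
  Submodule.Quotient.mk_eq_zero _

lemma exists_cls {n : ℤ} (x : L.H n) : ∃ z hd hz, L.cls z hd hz = x := by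
  obtain ⟨⟨z, hd, hz⟩, rfl⟩ := (L.boundaries n).mkQ_surjective x
  exact ⟨z, hd, hz, rfl⟩

namespace Hom

lemma d_map_eq_zero (f : Hom L M) {z : L.carrier} (hd : L.d z = 0) : M.d (f.toFun z) = 0 := by
  rw [← f.map_d, hd, map_zero]

lemma mapH_cls (f : Hom L M) {n : ℤ} {z : L.carrier} (hd : L.d z = 0) (hz : z ∈ L.gr n) :
    f.mapH n (L.cls z hd hz) = M.cls (f.toFun z) (f.d_map_eq_zero hd) (f.map_gr hz) := rfl

@[ext]
lemma ext {f g : Hom L M} (h : f.toFun = g.toFun) : f = g := by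
  cases f
  cases g
  congr

/-- The composition of morphisms. -/
def comp (g : Hom M N) (f : Hom L M) : Hom L N where
  toFun := g.toFun ∘ₗ f.toFun
  map_gr hx := g.map_gr (f.map_gr hx)
  map_br x y := by simp [f.map_br, g.map_br]
  map_d x := by simp [f.map_d, g.map_d]

lemma mapH_comp (g : Hom M N) (f : Hom L M) (n : ℤ) (x : L.H n) :
    (g.comp f).mapH n x = g.mapH n (f.mapH n x) := by
  obtain ⟨z, hd, hz, rfl⟩ := exists_cls x
  rfl

end Hom

end Homology

section AcyclicFibration

variable {L : DGLie.{u}} {M : DGLie.{v}}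

/-- Acyclic fibrations, in the form of their lifting property against the inclusion of a sphere
into a disk: a primitive of the image of a cycle lifts to a primitive of the cycle. This is
equivalent to being a quasi-isomorphism which is surjective in every degree. -/
def Hom.IsAcyclicFibration (f : Hom L M) : Prop :=
  ∀ ⦃n : ℤ⦄ ⦃z : L.carrier⦄, z ∈ L.gr (n - 1) → L.d z = 0 →
    ∀ ⦃y : M.carrier⦄, y ∈ M.gr n → M.d y = f.toFun z →
      ∃ x ∈ L.gr n, L.d x = z ∧ f.toFun x = y

namespace Hom

lemma IsAcyclicFibration.isQuasiIso {f : Hom L M} (hf : f.IsAcyclicFibration) :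
    f.IsQuasiIso := by
  refine fun n => ⟨(injective_iff_map_eq_zero _).2 fun x hx => ?_, fun y => ?_⟩
  · obtain ⟨z, hd, hz, rfl⟩ := exists_cls x
    obtain ⟨y, hy, hyz⟩ := (cls_eq_zero_iff (f.d_map_eq_zero hd) (f.map_gr hz)).1 hx
    obtain ⟨x, hx, hxz, -⟩ := hf (by rwa [add_sub_cancel_right]) hd hy hyz
    exact (cls_eq_zero_iff hd hz).2 ⟨x, hx, hxz⟩
  · obtain ⟨z, hd, hz, rfl⟩ := exists_cls y
    obtain ⟨x, hx, hxd, rfl⟩ := hf (zero_mem _) (map_zero _) hz (by rw [hd, map_zero])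
    exact ⟨L.cls x hxd hx, rfl⟩

lemma IsQuasiIso.isAcyclicFibration {f : Hom L M} (hf : f.IsQuasiIso)
    (hsurj : ∀ ⦃n y⦄, y ∈ M.gr n → ∃ x ∈ L.gr n, f.toFun x = y) : f.IsAcyclicFibration := by
  intro n z hz hdz y hy hyz
  obtain ⟨x, hx, hxz⟩ : ∃ x ∈ L.gr n, L.d x = z := by
    have hcls : L.cls z hdz hz = 0 := by
      refine (injective_iff_map_eq_zero _).1 (hf (n - 1)).1 _ ?_
      exact (cls_eq_zero_iff (f.d_map_eq_zero hdz) (f.map_gr hz)).2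
        ⟨y, by rwa [sub_add_cancel], hyz⟩
    simpa only [sub_add_cancel] using (cls_eq_zero_iff hdz hz).1 hcls
  have hdy : M.d (y - f.toFun x) = 0 := by rw [map_sub, hyz, ← f.map_d, hxz, sub_self]
  obtain ⟨c, hc, hdc, e, he, hec⟩ : ∃ c ∈ L.gr n, L.d c = 0 ∧
      ∃ e ∈ M.gr (n + 1), M.d e = y - f.toFun x - f.toFun c := by
    obtain ⟨c, hc⟩ := (hf n).2 (M.cls _ hdy (sub_mem hy (f.map_gr hx)))
    obtain ⟨c, hdc, hcn, rfl⟩ := exists_cls c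
    exact ⟨c, hcn, hdc, (cls_eq_cls_iff hdy (sub_mem hy (f.map_gr hx)) (f.d_map_eq_zero hdc)
      (f.map_gr hcn)).1 hc.symm⟩
  obtain ⟨e', he', rfl⟩ := hsurj he
  have hde' : L.d e' ∈ L.gr n := by simpa using L.isDerivation.d_mem he'
  refine ⟨x + c + L.d e', add_mem (add_mem hx hc) hde', ?_, ?_⟩
  · rw [map_add, map_add, hxz, hdc, L.d_d, add_zero, add_zero]
  · rw [map_add, map_add, f.map_d, hec]
    abel

end Hom

end AcyclicFibration

section Pullback

variable {L : DGLie.{u}} {M : DGLie.{v}} {N : DGLie.{w}}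

/-- The underlying space of the pullback `L ×_N M`. -/
abbrev pullbackCarrier (f : Hom L N) (g : Hom M N) : Submodule ℚ (L.carrier × M.carrier) :=
  LinearMap.eqLocus (f.toFun ∘ₗ .fst ℚ L.carrier M.carrier) (g.toFun ∘ₗ .snd ℚ L.carrier M.carrier)

lemma map_fst_eq_map_snd {f : Hom L N} {g : Hom M N} (x : pullbackCarrier f g) :
    f.toFun x.1.1 = g.toFun x.1.2 :=
  x.2

/-- The bracket of the pullback `L ×_N M`. -/
def pullbackBr (f : Hom L N) (g : Hom M N) :
    pullbackCarrier f g →ₗ[ℚ] pullbackCarrier f g →ₗ[ℚ] pullbackCarrier f g :=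
  LinearMap.mk₂ ℚ
    (fun x y => ⟨(L.br x.1.1 y.1.1, M.br x.1.2 y.1.2), by
      simp [f.map_br, g.map_br, map_fst_eq_map_snd]⟩)
    (fun x y z => by ext <;> simp) (fun c x y => by ext <;> simp)
    (fun x y z => by ext <;> simp) (fun c x y => by ext <;> simp)

/-- The differential of the pullback `L ×_N M`. -/
def pullbackD (f : Hom L N) (g : Hom M N) : pullbackCarrier f g →ₗ[ℚ] pullbackCarrier f g :=
  (L.d.prodMap M.d).restrict fun _ hx => by
    simpa [← f.map_d, ← g.map_d] using congrArg N.d hx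

/-- The elements of degree `n` of the pullback `L ×_N M`. -/
def pullbackGr (f : Hom L N) (g : Hom M N) (n : ℤ) : Submodule ℚ (pullbackCarrier f g) :=
  ((L.gr n).prod (M.gr n)).comap (pullbackCarrier f g).subtype

lemma isInternal_pullbackGr (f : Hom L N) (g : Hom M N) :
    DirectSum.IsInternal (pullbackGr f g) := by
  have h := isInternal_prod L.isGradedLie.internal M.isGradedLie.internal
  have hf : ∀ n, (L.gr n).prod (M.gr n) ≤
      (N.gr n).comap (f.toFun ∘ₗ .fst ℚ L.carrier M.carrier) := fun _ _ hx => f.map_gr hx.1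
  have hg : ∀ n, (L.gr n).prod (M.gr n) ≤
      (N.gr n).comap (g.toFun ∘ₗ .snd ℚ L.carrier M.carrier) := fun _ _ hx => g.map_gr hx.2
  exact isInternal_comap_eqLocus h N.isGradedLie.internal hf hg

/-- The pullback `L ×_N M` of a cospan `L → N ← M`. -/
def pullback (f : Hom L N) (g : Hom M N) : DGLie.{max u v} where
  carrier := pullbackCarrier f g
  gr := pullbackGr f g
  br := pullbackBr f g
  d := pullbackD f g
  isGradedLie :=
    { internal := isInternal_pullbackGr f g
      br_mem := fun hx hy => ⟨L.isGradedLie.br_mem hx.1 hy.1, M.isGradedLie.br_mem hx.2 hy.2⟩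
      br_anti := fun hx hy => Subtype.ext <|
        Prod.ext (L.isGradedLie.br_anti hx.1 hy.1) (M.isGradedLie.br_anti hx.2 hy.2)
      jacobi := fun hx hy hz => Subtype.ext <|
        Prod.ext (L.isGradedLie.jacobi hx.1 hy.1 hz.1) (M.isGradedLie.jacobi hx.2 hy.2 hz.2) }
  isDerivation :=
    { d_mem := fun hx => ⟨L.isDerivation.d_mem hx.1, M.isDerivation.d_mem hx.2⟩
      leibniz := fun _ hx => Subtype.ext <|
        Prod.ext (L.isDerivation.leibniz _ hx.1) (M.isDerivation.leibniz _ hx.2) }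
  d_d _ := Subtype.ext <| Prod.ext (L.d_d _) (M.d_d _)

namespace pullback

variable {f : Hom L N} {g : Hom M N}

/-- The first projection of a pullback. -/
def fst : Hom (pullback f g) L where
  toFun := .fst ℚ _ _ ∘ₗ Submodule.subtype _
  map_gr hx := hx.1
  map_br _ _ := rfl
  map_d _ := rfl

/-- The second projection of a pullback. -/
def snd : Hom (pullback f g) M where
  toFun := .snd ℚ _ _ ∘ₗ Submodule.subtype _
  map_gr hx := hx.2
  map_br _ _ := rfl
  map_d _ := rfl

lemma condition : f.comp fst = g.comp (snd : Hom (pullback f g) M) :=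
  Hom.ext (LinearMap.ext map_fst_eq_map_snd)

lemma isAcyclicFibration_fst (hg : g.IsAcyclicFibration) :
    (fst : Hom (pullback f g) L).IsAcyclicFibration := by
  intro n z hz hdz x hx hxz
  have hfx : N.d (f.toFun x) = g.toFun z.1.2 := by
    rw [← f.map_d, hxz, ← map_fst_eq_map_snd z]
    rfl
  obtain ⟨y, hy, hyz, hxy⟩ := hg hz.2 (congrArg (fun t => t.1.2) hdz) (f.map_gr hx) hfx
  exact ⟨⟨(x, y), hxy.symm⟩, ⟨hx, hy⟩, Subtype.ext (Prod.ext hxz hyz), rfl⟩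

end pullback

end Pullback

end DGLie

namespace DGLie

section Path

open Polynomial
open DirectSum (decomposeTensor)

/-- The path object `L ⊗ ℚ[t, dt]` of a differential graded Lie algebra, where `t` and `dt` have
degrees `0` and `-1`. The pair `(a, b)` stands for `a + dt b`, with `a` and `b` in `L ⊗ ℚ[t]`. -/
noncomputable def path (L : DGLie.{u}) : DGLie.{u} where
  carrier := (L.carrier ⊗[ℚ] ℚ[X]) × (L.carrier ⊗[ℚ] ℚ[X])
  gr := DtExtension.gr (decomposeTensor L.gr ℚ[X])
  br := DtExtension.br (signOp (isGradedLie_tensor L.isGradedLie).internal) (tensorBr ℚ[X] L.br)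
  d := DtExtension.diff (L.d.rTensor ℚ[X]) (derivative.lTensor L.carrier)
  isGradedLie := DtExtension.isGradedLie (isGradedLie_tensor L.isGradedLie)
  isDerivation := DtExtension.isDerivation (isGradedLie_tensor L.isGradedLie)
    (isDerivation_rTensor L.isDerivation) (lTensor_mem_decomposeTensor derivative)
    (lTensor_tensorBr (fun _ _ => derivative_mul) L.br)
  d_d := DtExtension.diff_diff
    (fun x => by
      rw [← LinearMap.rTensor_comp_apply, LinearMap.ext (f := L.d ∘ₗ L.d) (g := 0) L.d_d,
        LinearMap.rTensor_zero, LinearMap.zero_apply])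
    (rTensor_lTensor_comm L.d derivative)

namespace path

variable {L : DGLie.{u}}

/-- The evaluation `t ↦ c`, `dt ↦ 0` of paths. -/
noncomputable def ev (c : ℚ) : Hom L.path L where
  toFun := evalAt c ∘ₗ .fst ℚ _ _
  map_gr hx := evalAt_mem c hx.1
  map_br x y := evalAt_tensorBr c L.br x.1 y.1
  map_d x := evalAt_rTensor c L.d x.1

lemma derivative_fst_eq {z : L.path.carrier} (hdz : L.path.d z = 0) :
    derivative.lTensor L.carrier z.1 = L.d.rTensor ℚ[X] z.2 :=
  sub_eq_zero.1 (congrArg Prod.snd hdz)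

lemma sub_evalAt_zero_eq {z : L.path.carrier} (hdz : L.path.d z = 0) :
    z.1 - evalAt 0 z.1 ⊗ₜ 1 = L.d.rTensor ℚ[X] (antideriv.lTensor L.carrier z.2) := by
  rw [rTensor_lTensor_comm, ← derivative_fst_eq hdz, antideriv_derivative_lTensor]

lemma isAcyclicFibration_ev_zero : (ev 0 : Hom L.path L).IsAcyclicFibration := by
  intro n z hz hdz y hy hyz
  have hz₂ : z.2 ∈ decomposeTensor L.gr ℚ[X] n := by simpa using hz.2
  refine ⟨(y ⊗ₜ 1 + antideriv.lTensor L.carrier z.2, 0),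
    ⟨add_mem (tmul_mem_decomposeTensor hy 1) (lTensor_mem_decomposeTensor _ hz₂), zero_mem _⟩,
    Prod.ext ?_ ?_, ?_⟩
  · change L.d.rTensor ℚ[X] (y ⊗ₜ 1 + antideriv.lTensor L.carrier z.2) = z.1
    rw [map_add, LinearMap.rTensor_tmul, hyz, ← sub_evalAt_zero_eq hdz]
    exact add_sub_cancel _ _
  · change derivative.lTensor L.carrier (y ⊗ₜ 1 + antideriv.lTensor L.carrier z.2) -
      L.d.rTensor ℚ[X] 0 = z.2
    rw [map_add, LinearMap.lTensor_tmul, derivative_antideriv_lTensor, derivative_one,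
      TensorProduct.tmul_zero, zero_add, map_zero, sub_zero]
  · change evalAt 0 (y ⊗ₜ 1 + antideriv.lTensor L.carrier z.2) = y
    rw [map_add, evalAt_tmul, evalAt_zero_antideriv, eval_one, one_smul, add_zero]

lemma mapH_ev_one (n : ℤ) (x : L.path.H n) : (ev 1).mapH n x = (ev 0).mapH n x := by
  obtain ⟨z, hdz, hz, rfl⟩ := exists_cls x
  rw [Hom.mapH_cls, Hom.mapH_cls, cls_eq_cls_iff]
  refine ⟨evalAt 1 (antideriv.lTensor L.carrier z.2),
    evalAt_mem 1 (lTensor_mem_decomposeTensor _ hz.2), ?_⟩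
  rw [← evalAt_rTensor, ← sub_evalAt_zero_eq hdz, map_sub, evalAt_tmul, eval_one, one_smul]
  rfl

end path

end Path

section MappingPath

variable {L : DGLie.{u}} {M : DGLie.{v}}

/-- The mapping path object of `f : L → M`: the elements of `L` together with a path in `M` starting
at their image. -/
noncomputable abbrev mappingPath (f : Hom L M) : DGLie.{max u v} := pullback f (path.ev 0)

namespace mappingPath

/-- The projection of the mapping path object to the source of `f`. -/
noncomputable def source (f : Hom L M) : Hom (mappingPath f) L := pullback.fst

/-- The projection of the mapping path object to the end point of the path. -/
noncomputable def target (f : Hom L M) : Hom (mappingPath f) M := (path.ev 1).comp pullback.snd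

variable {f : Hom L M}

lemma isAcyclicFibration_source : (source f).IsAcyclicFibration :=
  pullback.isAcyclicFibration_fst path.isAcyclicFibration_ev_zero

lemma mapH_target (n : ℤ) (x : (mappingPath f).H n) :
    (target f).mapH n x = f.mapH n ((source f).mapH n x) := by
  rw [target, source, Hom.mapH_comp, path.mapH_ev_one, ← Hom.mapH_comp, ← Hom.mapH_comp,
    pullback.condition]

open Polynomial in
lemma target_surjective {n : ℤ} {y : M.carrier} (hy : y ∈ M.gr n) :
    ∃ x ∈ (mappingPath f).gr n, (target f).toFun x = y := by
  have hyX : f.toFun 0 = evalAt 0 (y ⊗ₜ[ℚ] (X : ℚ[X])) := by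
    rw [map_zero, evalAt_tmul, eval_X, zero_smul]
  refine ⟨⟨(0, (y ⊗ₜ X, 0)), hyX⟩, ⟨zero_mem _, tmul_mem_decomposeTensor hy _, zero_mem _⟩, ?_⟩
  change evalAt 1 (y ⊗ₜ[ℚ] (X : ℚ[X])) = y
  rw [evalAt_tmul, eval_X, one_smul]

lemma isAcyclicFibration_target (hf : f.IsQuasiIso) : (target f).IsAcyclicFibration := by
  refine Hom.IsQuasiIso.isAcyclicFibration (fun n => ?_) fun n y hy => target_surjective hy
  rw [funext (mapH_target (f := f) n)]
  exact (hf n).comp (isAcyclicFibration_source.isQuasiIso n)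

end mappingPath

end MappingPath

end DGLie

lemma exists_forall_of_step {ι : Type*} [Preorder ι] [WellFoundedLT ι] {α : ι → Type*}
    [∀ i, Nonempty (α i)] {p : ∀ i, (∀ j, α j) → α i → Prop}
    (congr : ∀ {i v v' y}, (∀ j < i, v j = v' j) → p i v y → p i v' y)
    (step : ∀ i v, (∀ j < i, p j v (v j)) → ∃ y, p i v y) : ∃ v, ∀ i, p i v (v i) := by
  classical
  let extend (i : ι) (v : ∀ j < i, α j) (j : ι) : α j :=
    if hj : j < i then v j hj else Classical.arbitrary _
  let v : ∀ i, α i := wellFounded_lt.fix fun i v => Classical.epsilon (p i (extend i v))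
  have hv (i : ι) : v i = Classical.epsilon (p i (extend i fun j _ => v j)) :=
    wellFounded_lt.fix_eq _ i
  have hextend (i j : ι) (hj : j < i) : v j = extend i (fun j _ => v j) j := by
    simp only [extend, dif_pos hj]
  refine ⟨v, fun i => ?_⟩
  induction i using WellFoundedLT.induction with
  | ind i ih =>
    obtain ⟨y, hy⟩ := step i v ih
    have hi := Classical.epsilon_spec ⟨y, congr (hextend i) hy⟩
    rw [← hv] at hi
    exact congr (fun j hj => (hextend i j hj).symm) hi

namespace FreeGradedLie

variable {ι : Type*} {V W : Type*} [AddCommGroup V] [Module ℚ V] [AddCommGroup W] [Module ℚ W]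
  {b : V →ₗ[ℚ] V →ₗ[ℚ] V} {b' : W →ₗ[ℚ] W →ₗ[ℚ] W} {v : ι → V} {deg : ι → ℤ}
  {δ : ι → FreeMagma ι →₀ ℚ}

section Words

/-- The set of letters of a non-associative monomial. -/
def letters : FreeMagma ι → Set ι
  | .of i => {i}
  | .mul a b => letters a ∪ letters b

/-- The non-associative polynomials in the letters from `s`. -/
noncomputable def words (s : Set ι) : Submodule ℚ (FreeMagma ι →₀ ℚ) :=
  Submodule.span ℚ (mon '' {a | letters a ⊆ s})

lemma mon_mem_words {s : Set ι} {a : FreeMagma ι} (ha : letters a ⊆ s) : mon a ∈ words s :=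
  Submodule.subset_span ⟨a, ha, rfl⟩

lemma words_le {s : Set ι} {S : Submodule ℚ (FreeMagma ι →₀ ℚ)}
    (h : ∀ a, letters a ⊆ s → mon a ∈ S) : words s ≤ S := by
  refine Submodule.span_le.2 ?_
  rintro _ ⟨a, ha, rfl⟩
  exact h a ha

lemma mem_words_univ (x : FreeMagma ι →₀ ℚ) : x ∈ words Set.univ :=
  lin_ext (fun _ => mon_mem_words (Set.subset_univ _)) x

lemma mulNA_mem_words {s : Set ι} {x y : FreeMagma ι →₀ ℚ} (hx : x ∈ words s)
    (hy : y ∈ words s) : mulNA x y ∈ words s := by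
  have hmon (a : FreeMagma ι) (ha : letters a ⊆ s) : words s ≤ (words s).comap (mulNA (mon a)) :=
    words_le fun c hc => by
      rw [Submodule.mem_comap, mulNA_mon]
      exact mon_mem_words (Set.union_subset ha hc)
  have h : words s ≤ (words s).comap (mulNA.flip y) := words_le fun a ha => hmon a ha hy
  exact h hx

end Words

section Evaluation

/-- The value of a non-associative monomial in an algebra with multiplication `b`. -/
def evalMon (b : V →ₗ[ℚ] V →ₗ[ℚ] V) (v : ι → V) : FreeMagma ι → V
  | .of i => v i
  | .mul a c => b (evalMon b v a) (evalMon b v c)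

/-- The value of a non-associative polynomial in an algebra with multiplication `b`. -/
noncomputable def evalNA (b : V →ₗ[ℚ] V →ₗ[ℚ] V) (v : ι → V) : (FreeMagma ι →₀ ℚ) →ₗ[ℚ] V :=
  Finsupp.linearCombination ℚ (evalMon b v)

lemma evalNA_mon (a : FreeMagma ι) : evalNA b v (mon a) = evalMon b v a := by
  simp [evalNA, mon]

lemma map_evalNA (f : V →ₗ[ℚ] W) (hf : ∀ x y, f (b x y) = b' (f x) (f y))
    (x : FreeMagma ι →₀ ℚ) : f (evalNA b v x) = evalNA b' (fun i => f (v i)) x := by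
  refine lin_ext (S := LinearMap.eqLocus (f ∘ₗ evalNA b v) (evalNA b' fun i => f (v i)))
    (fun a => ?_) x
  rw [LinearMap.mem_eqLocus, LinearMap.comp_apply, evalNA_mon, evalNA_mon]
  induction a with
  | ih1 i => rfl
  | ih2 a c iha ihc => exact (hf _ _).trans (congrArg₂ (fun x y => b' x y) iha ihc)

lemma evalNA_congr {v' : ι → V} {s : Set ι} (hv : ∀ i ∈ s, v i = v' i) {x : FreeMagma ι →₀ ℚ}
    (hx : x ∈ words s) : evalNA b v x = evalNA b v' x := by
  have h : words s ≤ LinearMap.eqLocus (evalNA b v) (evalNA b v') := words_le fun a ha => by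
    rw [LinearMap.mem_eqLocus, evalNA_mon, evalNA_mon]
    induction a with
    | ih1 i => exact hv i (ha rfl)
    | ih2 a c iha ihc =>
      obtain ⟨ha, hc⟩ := Set.union_subset_iff.1 ha
      exact congrArg₂ (fun x y => b x y) (iha ha) (ihc hc)
  exact h hx

lemma evalNA_mul (x y : FreeMagma ι →₀ ℚ) :
    evalNA b v (mulNA x y) = b (evalNA b v x) (evalNA b v y) := by
  have h : mulNA.compr₂ (evalNA b v) = b.compl₁₂ (evalNA b v) (evalNA b v) := by
    ext a c
    simp [mulNA, evalNA, mon, evalMon]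
  exact LinearMap.congr_fun₂ h x y

lemma mkQ_eq_evalNA (x : FreeMagma ι →₀ ℚ) :
    (relIdeal deg).mkQ x = evalNA (br deg) (gen deg) x := by
  refine lin_ext (S := LinearMap.eqLocus (relIdeal deg).mkQ (evalNA (br deg) (gen deg)))
    (fun a => ?_) x
  rw [LinearMap.mem_eqLocus, evalNA_mon]
  induction a with
  | ih1 i => rfl
  | ih2 a c iha ihc =>
    change (relIdeal deg).mkQ (mon (a.mul c)) = br deg (evalMon _ _ a) (evalMon _ _ c)
    rw [← mulNA_mon, ← br_mk, iha, ihc]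

variable {g : ℤ → Submodule ℚ V} {d : V →ₗ[ℚ] V}

lemma evalMon_mem (h : IsGradedLie g b) (hv : ∀ i, v i ∈ g (deg i)) (a : FreeMagma ι) :
    evalMon b v a ∈ g (mdeg deg a) := by
  induction a with
  | ih1 i => exact hv i
  | ih2 a c iha ihc => exact h.br_mem iha ihc

lemma evalNA_mem (h : IsGradedLie g b) (hv : ∀ i, v i ∈ g (deg i)) {n : ℤ}
    {x : FreeMagma ι →₀ ℚ} (hx : x ∈ grNA deg n) : evalNA b v x ∈ g n := by
  have hle : grNA deg n ≤ (g n).comap (evalNA b v) := grNA_le fun a ha => by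
    rw [Submodule.mem_comap, evalNA_mon, ← ha]
    exact evalMon_mem h hv a
  exact hle hx

lemma relIdeal_le_ker_evalNA (h : IsGradedLie g b) (hv : ∀ i, v i ∈ g (deg i)) :
    relIdeal deg ≤ LinearMap.ker (evalNA b v) := by
  have hmon (a : FreeMagma ι) : evalNA b v (mon a) ∈ g (mdeg deg a) :=
    evalNA_mem h hv (mon_mem deg a)
  refine Submodule.span_le.2 fun r hr => ?_
  rw [SetLike.mem_coe, LinearMap.mem_ker]
  induction hr with
  | anti a c =>
    rw [map_add, map_smul, evalNA_mul, evalNA_mul, h.br_anti (hmon a) (hmon c)]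
    exact neg_add_cancel _
  | jacobi a c e =>
    simp only [map_sub, map_smul, evalNA_mul]
    rw [h.jacobi (hmon a) (hmon c) (hmon e)]
    abel
  | mul_left a _ ih => rw [evalNA_mul, ih, map_zero]
  | mul_right a _ ih => rw [evalNA_mul, ih, map_zero, LinearMap.zero_apply]

lemma evalNA_derNA (h : IsGradedLie g b) (hd : IsDerivation g b d) (hv : ∀ i, v i ∈ g (deg i))
    {s : Set ι} (hdv : ∀ i ∈ s, d (v i) = evalNA b v (δ i)) {x : FreeMagma ι →₀ ℚ}
    (hx : x ∈ words s) : evalNA b v (derNA deg δ x) = d (evalNA b v x) := by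
  have hle : words s ≤ LinearMap.eqLocus (evalNA b v ∘ₗ derNA deg δ) (d ∘ₗ evalNA b v) := by
    refine words_le fun a ha => ?_
    rw [LinearMap.mem_eqLocus, LinearMap.comp_apply, LinearMap.comp_apply, derNA_mon, evalNA_mon]
    induction a with
    | ih1 i => exact (hdv i (ha rfl)).symm
    | ih2 a c iha ihc =>
      obtain ⟨ha, hc⟩ := Set.union_subset_iff.1 ha
      change evalNA b v (mulNA (derMon deg δ a) (mon c) +
        (-1 : ℚ) ^ mdeg deg a • mulNA (mon a) (derMon deg δ c)) = d (b (evalMon b v a) _)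
      rw [hd.leibniz _ (evalMon_mem h hv a), map_add, map_smul, evalNA_mul, evalNA_mul,
        iha ha, ihc hc, evalNA_mon, evalNA_mon]
  exact hle hx

end Evaluation

end FreeGradedLie

namespace freeDGLie

open FreeGradedLie

variable {ι : Type*} {deg : ι → ℤ} {δ : ι → FreeMagma ι →₀ ℚ}
  {hδ : ∀ i, δ i ∈ grNA deg (deg i - 1)}
  {h0 : ∀ i, der deg δ hδ (der deg δ hδ (gen deg i)) = 0} {L : DGLie.{u}} {M : DGLie.{v}}

/-- The morphism out of a quasi-free differential graded Lie algebra with prescribed values on the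
generators. -/
noncomputable def liftHom (v : ι → L.carrier) (hv : ∀ i, v i ∈ L.gr (deg i))
    (hdv : ∀ i, L.d (v i) = evalNA L.br v (δ i)) : DGLie.Hom (freeDGLie deg δ hδ h0) L where
  toFun := (relIdeal deg).liftQ (evalNA L.br v) (relIdeal_le_ker_evalNA L.isGradedLie hv)
  map_gr := by
    rintro n _ ⟨x, hx, rfl⟩
    exact evalNA_mem L.isGradedLie hv hx
  map_br x y := by
    obtain ⟨x, rfl⟩ := (relIdeal deg).mkQ_surjective x
    obtain ⟨y, rfl⟩ := (relIdeal deg).mkQ_surjective y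
    exact evalNA_mul x y
  map_d x := by
    obtain ⟨x, rfl⟩ := (relIdeal deg).mkQ_surjective x
    exact evalNA_derNA L.isGradedLie L.isDerivation hv (fun i _ => hdv i) (mem_words_univ x)

lemma map_mkQ (f : DGLie.Hom (freeDGLie deg δ hδ h0) L) (x : FreeMagma ι →₀ ℚ) :
    f.toFun ((relIdeal deg).mkQ x) = evalNA L.br (fun i => f.toFun (gen deg i)) x :=
  (congrArg f.toFun (mkQ_eq_evalNA x)).trans (map_evalNA f.toFun f.map_br x)

lemma d_map_gen (f : DGLie.Hom (freeDGLie deg δ hδ h0) L) (i : ι) :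
    L.d (f.toFun (gen deg i)) = evalNA L.br (fun j => f.toFun (gen deg j)) (δ i) :=
  (f.map_d _).symm.trans ((congrArg f.toFun (der_gen deg δ hδ i)).trans (map_mkQ f (δ i)))

lemma hom_ext {f g : DGLie.Hom (freeDGLie deg δ hδ h0) L}
    (h : ∀ i, f.toFun (gen deg i) = g.toFun (gen deg i)) : f = g := by
  refine DGLie.Hom.ext (LinearMap.ext fun x => ?_)
  obtain ⟨x, rfl⟩ := (relIdeal deg).mkQ_surjective x
  rw [map_mkQ, map_mkQ, funext h]

lemma liftHom_gen {v : ι → L.carrier} (hv : ∀ i, v i ∈ L.gr (deg i))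
    (hdv : ∀ i, L.d (v i) = evalNA L.br v (δ i)) (i : ι) :
    (liftHom v hv hdv : DGLie.Hom (freeDGLie deg δ hδ h0) L).toFun (gen deg i) = v i :=
  evalNA_mon _

lemma d_evalNA_δ_eq_zero (h0 : ∀ i, der deg δ hδ (der deg δ hδ (gen deg i)) = 0)
    {v : ι → L.carrier} (hv : ∀ i, v i ∈ L.gr (deg i)) {s : Set ι}
    (hdv : ∀ j ∈ s, L.d (v j) = evalNA L.br v (δ j)) {i : ι} (hi : δ i ∈ words s) :
    L.d (evalNA L.br v (δ i)) = 0 := by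
  rw [← evalNA_derNA L.isGradedLie L.isDerivation hv hdv hi]
  refine relIdeal_le_ker_evalNA L.isGradedLie hv ((Submodule.Quotient.mk_eq_zero _).1 ?_)
  have h := h0 i
  rwa [der_gen] at h

lemma exists_comp_eq [Preorder ι] [WellFoundedLT ι] (hwords : ∀ i, δ i ∈ words (Set.Iio i))
    {f : DGLie.Hom L M} (hf : f.IsAcyclicFibration) (ψ : DGLie.Hom (freeDGLie deg δ hδ h0) M) :
    ∃ Φ : DGLie.Hom (freeDGLie deg δ hδ h0) L, f.comp Φ = ψ := by
  obtain ⟨v, hv⟩ := exists_forall_of_step (α := fun i => L.gr (deg i))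
    (p := fun i v y => L.d y = evalNA L.br (fun j => v j) (δ i) ∧
      f.toFun y = ψ.toFun (gen deg i))
    (fun {i v v' y} hvv' hy => ⟨hy.1.trans
      (evalNA_congr (fun j hj => congrArg Subtype.val (hvv' j hj)) (hwords i)), hy.2⟩)
    fun i v ih => by
      have hcycle := d_evalNA_δ_eq_zero h0 (fun j => (v j).2)
        (fun j hj => (ih j hj).1) (hwords i)
      have hψ : M.d (ψ.toFun (gen deg i)) = f.toFun (evalNA L.br (fun j => v j) (δ i)) := by
        rw [map_evalNA f.toFun f.map_br, evalNA_congr (fun j hj => (ih j hj).2) (hwords i)]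
        exact d_map_gen ψ i
      obtain ⟨y, hy, hdy, hfy⟩ := hf (evalNA_mem L.isGradedLie (fun j => (v j).2) (hδ i)) hcycle
        (ψ.map_gr (gen_mem deg i)) hψ
      exact ⟨⟨y, hy⟩, hdy, hfy⟩
  refine ⟨liftHom (fun i => v i) (fun i => (v i).2) fun i => (hv i).1, hom_ext fun i => ?_⟩
  exact (congrArg f.toFun (liftHom_gen _ _ i)).trans (hv i).2

end freeDGLie

namespace FatWedge

variable {k : ℕ} {n : Fin k → ℤ}

lemma genNA_mem_words {S : Index k} {A : Finset (Fin k)} (hA : A ⊂ S.1) :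
    genNA A ∈ FreeGradedLie.words (Set.Iio S) := by
  rw [genNA]
  split_ifs with h
  · exact FreeGradedLie.mon_mem_words (Set.singleton_subset_iff.2 hA)
  · exact zero_mem _

lemma δ_mem_words (S : Index k) : δ n S ∈ FreeGradedLie.words (Set.Iio S) := by
  refine sum_mem fun A hA => Submodule.smul_mem _ _ ?_
  obtain ⟨hAS, m, hm, -⟩ := Finset.mem_filter.1 hA
  have hAS := Finset.mem_ssubsets.1 hAS
  exact FreeGradedLie.mulNA_mem_words (genNA_mem_words hAS)
    (genNA_mem_words (Finset.sdiff_ssubset hAS.1 ⟨m, hm⟩))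

lemma exists_comp_eq {L : DGLie.{u}} {M : DGLie.{v}} {f : DGLie.Hom L M}
    (hf : f.IsAcyclicFibration) (ψ : DGLie.Hom (LieU n) M) :
    ∃ Φ : DGLie.Hom (LieU n) L, f.comp Φ = ψ :=
  freeDGLie.exists_comp_eq δ_mem_words hf ψ

end FatWedge

section WhiteheadBracket

variable {k : ℕ} {n : Fin k → ℤ} {L : DGLie.{u}} {M : DGLie.{v}} {f : DGLie.Hom L M}

lemma mapsTo_whiteheadBracket (f : DGLie.Hom L M) (x : ∀ i, L.H (n i - 1)) :
    Set.MapsTo (f.mapH (∑ i, n i - 2)) (whiteheadBracket L x)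
      (whiteheadBracket M fun i => f.mapH (n i - 1) (x i)) := by
  rintro _ ⟨Φ, hΦ, rfl⟩
  exact ⟨f.comp Φ, fun i => by rw [DGLie.Hom.mapH_comp, hΦ i], DGLie.Hom.mapH_comp _ _ _ _⟩

lemma surjOn_whiteheadBracket (hf : f.IsQuasiIso) (x : ∀ i, L.H (n i - 1)) :
    Set.SurjOn (f.mapH (∑ i, n i - 2)) (whiteheadBracket L x)
      (whiteheadBracket M fun i => f.mapH (n i - 1) (x i)) := by
  rintro _ ⟨ψ, hψ, rfl⟩
  obtain ⟨Φ, rfl⟩ := FatWedge.exists_comp_eq (DGLie.mappingPath.isAcyclicFibration_target hf) ψ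
  have hΦ (m : ℤ) (y : (FatWedge.LieU n).H m) :
      f.mapH m (((DGLie.mappingPath.source f).comp Φ).mapH m y) =
        ((DGLie.mappingPath.target f).comp Φ).mapH m y := by
    rw [DGLie.Hom.mapH_comp, DGLie.Hom.mapH_comp, DGLie.mappingPath.mapH_target]
  exact ⟨_, ⟨_, fun i => (hf _).1 ((hΦ _ _).trans (hψ i)), rfl⟩, hΦ _ _⟩

lemma bijOn_whiteheadBracket (hf : f.IsQuasiIso) (x : ∀ i, L.H (n i - 1)) :
    Set.BijOn (f.mapH (∑ i, n i - 2)) (whiteheadBracket L x)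
      (whiteheadBracket M fun i => f.mapH (n i - 1) (x i)) :=
  ⟨mapsTo_whiteheadBracket f x, (hf _).1.injOn, surjOn_whiteheadBracket hf x⟩

lemma zero_mem_whiteheadBracket_iff (hf : f.IsQuasiIso) (x : ∀ i, L.H (n i - 1)) :
    (0 : L.H (∑ i, n i - 2)) ∈ whiteheadBracket L x ↔
      (0 : M.H (∑ i, n i - 2)) ∈ whiteheadBracket M fun i => f.mapH (n i - 1) (x i) := by
  refine ⟨fun h => map_zero (f.mapH (∑ i, n i - 2)) ▸ mapsTo_whiteheadBracket f x h, fun h => ?_⟩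
  obtain ⟨y, hy, hy0⟩ := surjOn_whiteheadBracket hf x h
  rwa [(injective_iff_map_eq_zero _).1 (hf _).1 y hy0] at hy

end WhiteheadBracket

theorem proposition1p4 {k : ℕ} (hk : 2 ≤ k) (n : Fin k → ℤ) (L : DGLie.{u}) (L' : DGLie.{v})
    (φ : DGLie.Hom L L') (hφ : φ.IsQuasiIso) (x : ∀ i, L.H (n i - 1)) :
    ((0 : L.H (∑ i, n i - 2)) ∈ whiteheadBracket L x ↔
      (0 : L'.H (∑ i, n i - 2)) ∈ whiteheadBracket L' fun i => φ.mapH (n i - 1) (x i)) ∧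
    Set.BijOn (φ.mapH (∑ i, n i - 2)) (whiteheadBracket L x)
      (whiteheadBracket L' fun i => φ.mapH (n i - 1) (x i)) ∧
    Cardinal.lift.{v} (Cardinal.mk (whiteheadBracket L x)) =
      Cardinal.lift.{u} (Cardinal.mk (whiteheadBracket L' fun i => φ.mapH (n i - 1) (x i))) := by
  have h := bijOn_whiteheadBracket hφ x
  exact ⟨zero_mem_whiteheadBracket_iff hφ x, h, Cardinal.lift_mk_eq'.2 ⟨h.equiv⟩⟩
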